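/- **Setting.** A finite set of bidders carries a fixed linear order (the lexicographic order, used to break ties). There are $m$ slots; slot $j$ receives $D_j$ clicks at a constant rate during $[0,1]$, where $D_1>D_2>\dots>D_m\ge 0$; put $D_j=0$ for $j>m$. Each bidder $i$ declares a bid $b_i\ge 0$ and a budget $B_i\ge 0$. A *feasible schedule* assigns to each bidder a finite set of pairs $(j,[\alpha,\beta))$ with $0\le\alpha<\beta\le1$ such that the intervals of each slot do not overlap and the intervals of each bidder do not overlap; bidder $i$ receives $c_i=\sum(\beta-\alpha)D_j$ clicks, summed over her pairs. A *mechanism* maps every profile of declarations to a feasible schedule and prices per click $p_i\le b_i$ with $p_ic_i\le B_i$. A bidder whose true maximum cost per click is $m_i\ge 0$ and whose true budget is $B_i^*\ge 0$ has utility $c_i$ if $p_i\le m_i$ and $c_ip_i\le B_i^*$, and $-\infty$ otherwise. For values $v$, write $v_i\succ v_j$ if $v_i>v_j$, or if $v_i=v_j$ and $i$ occurs first in the order. *Find-Price-Block* takes bidders with budgets $B_1\succ\dots\succ B_k$ and slots with $D_1\ge\dots\ge D_k$ clicks, $D_1>0$. It sets $r_\ell=\sum_{i\le\ell}B_i/\sum_{i\le\ell}D_i$,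 price $p=\max_\ell r_\ell$, and lets $\ell^*$ be the largest $\ell$ with $r_\ell=p$. Slots $1,\dots,\ell^*$ are allocated to bidders $1,\dots,\ell^*$ at price $p$, with $c_i=B_i/p$ (and $c_i=0$ if $p=0$). The *price-setting mechanism* repeats the following until no bidder remains or all remaining slots have no clicks (bidders left over get $0$ clicks and price $0$). Number the remaining bidders so that $b_1\succ b_2\succ\dots\succ b_n$. Let $k$ be the first index such that Find-Price-Block on bidders $1,\dots,k$ and the remaining slots gives a price $p\ge b_{k+1}$ (this condition is void for $k=n$). Reduce $B_k$, as little as possible, until Find-Price-Block on bidders $1,\dots,k$ gives a price $p\le b_k$. Apply the resulting allocation, in which the bidders of the block are scheduled in the slots of the block, and remove these bidders and slots. **Theorem 5.** The price-setting mechanism is well defined: for all declarations there is a feasible schedule that realizes the allocation, so that it is a mechanism as defined above. It is truthful: for every bidder $i$ with true maximum cost per click $m_i$ and true budget $B_i^*$, and for all declarations of the other bidders, declaring $(m_i,B_i^*)$ gives bidder $i$ at least the utility of any other declaration $(b,B)$, provided that $b\le m_i$ or that no bidder who precedes $i$ in the lexicographic order declares a bid exactly equal to $m_i$. Moreover, for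 arbitrary fixed declarations of the other bidders (ties included), the number of clicks that a bidder receives is non-decreasing in her declared bid and in her declared budget. -/

import Mathlib

open scoped NNReal

noncomputable section

namespace AdSlots

/-! The problem: declarations, schedules, mechanisms and utilities. -/

/-- What a bidder declares (or, for her true type, what she has): a maximum cost per click
and a budget. -/
structure Declaration where
  bid : ℝ≥0
  budget : ℝ≥0

/-- A pair `(j, [start, finish))` of a slot and a time interval. -/
structure Placement (m : ℕ) where
  slot : Fin m
  start : ℝ
  finish : ℝ

/-- A schedule assigns to each bidder a finite set of (slot, time interval) pairs. -/
def Schedule (ι : Type*) (m : ℕ) : Type _ := ι → Finset (Placement m)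

/-- All intervals are nonempty and lie in `[0, 1]`, the intervals of a slot do not overlap, and
the intervals of a bidder do not overlap. -/
structure Schedule.Feasible {ι : Type*} {m : ℕ} (σ : Schedule ι m) : Prop where
  interval : ∀ i, ∀ a ∈ σ i, 0 ≤ a.start ∧ a.start < a.finish ∧ a.finish ≤ 1
  slot_disjoint : ∀ i i', ∀ a ∈ σ i, ∀ a' ∈ σ i', (i, a) ≠ (i', a') → a.slot = a'.slot →
    Disjoint (Set.Ico a.start a.finish) (Set.Ico a'.start a'.finish)
  bidder_disjoint : ∀ i, ∀ a ∈ σ i, ∀ a' ∈ σ i, a ≠ a' →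
    Disjoint (Set.Ico a.start a.finish) (Set.Ico a'.start a'.finish)

/-- The number of clicks that a schedule gives to bidder `i` if slot `j` receives `D j` clicks
at a constant rate during `[0, 1]`. -/
def Schedule.clicks {ι : Type*} {m : ℕ} (D : Fin m → ℝ≥0) (σ : Schedule ι m) (i : ι) : ℝ :=
  ∑ a ∈ σ i, (a.finish - a.start) * (D a.slot : ℝ)

/-- A mechanism maps every profile of declarations to a feasible schedule and a price per click
for each bidder that is at most her bid, such that nobody is charged more than her budget. -/
structure Mechanism (ι : Type*) {m : ℕ} (D : Fin m → ℝ≥0) where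
  schedule : (ι → Declaration) → Schedule ι m
  price : (ι → Declaration) → ι → ℝ≥0
  feasible : ∀ r, (schedule r).Feasible
  price_le_bid : ∀ r i, price r i ≤ (r i).bid
  charge_le_budget : ∀ r i, (price r i : ℝ) * (schedule r).clicks D i ≤ (r i).budget

/-- The number of clicks that bidder `i` receives under the declarations `r`. -/
def Mechanism.clicks {ι : Type*} {m : ℕ} {D : Fin m → ℝ≥0} (M : Mechanism ι D)
    (r : ι → Declaration) (i : ι) : ℝ :=
  (M.schedule r).clicks D i

open Classical in
/-- The utility of `c` clicks at price `p` per click for a bidder with true type `t`: the number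
of clicks if her true maximum cost per click and her true budget are respected, else `-∞`. -/
def clickUtility (t : Declaration) (c p : ℝ) : EReal :=
  if p ≤ t.bid ∧ c * p ≤ t.budget then (c : EReal) else ⊥

/-- The utility of bidder `i` with true type `t` when the declarations are `r`. -/
def Mechanism.utility {ι : Type*} {m : ℕ} {D : Fin m → ℝ≥0} (M : Mechanism ι D)
    (t : Declaration) (i : ι) (r : ι → Declaration) : EReal :=
  clickUtility t (M.clicks r i) (M.price r i)

/-! Rankings. The linear order of the bidders is the fixed lexicographic order for ties. -/

section Ranking

variable {ι : Type*} [LinearOrder ι]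

/-- `i` is ranked before `j`: her value is larger, or it is equal and `i` occurs first. -/
def Before (v : ι → ℝ≥0) (i j : ι) : Prop := v j < v i ∨ (v i = v j ∧ i < j)

instance (v : ι → ℝ≥0) (i j : ι) : Decidable (Before v i j) :=
  inferInstanceAs (Decidable (_ ∨ _))

/-- The number of members of `S` that are ranked before `i`. -/
def rank (v : ι → ℝ≥0) (S : Finset ι) (i : ι) : ℕ := (S.filter (fun j => Before v j i)).card

/-- The first `l` members of `S` (all of them if there are fewer). -/
def leaders (v : ι → ℝ≥0) (S : Finset ι) (l : ℕ) : Finset ι :=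
  S.filter (fun i => rank v S i < l)

/-! The routine Find-Price-Block, for the bidders `S` with budgets `B` and slots with
`D 0, D 1, …` clicks. -/

/-- The sum of the `l` largest budgets divided by the number of clicks in the first `l` slots. -/
def ratio (B : ι → ℝ≥0) (D : ℕ → ℝ≥0) (S : Finset ι) (l : ℕ) : ℝ≥0 :=
  (∑ i ∈ leaders B S l, B i) / ∑ j ∈ Finset.range l, D j

/-- The price of the block: the largest ratio. -/
def blockPrice (B : ι → ℝ≥0) (D : ℕ → ℝ≥0) (S : Finset ι) : ℝ≥0 :=
  (Finset.Icc 1 S.card).sup (ratio B D S)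

/-- The length of the block: the last index at which the largest ratio is attained. -/
def blockLength (B : ι → ℝ≥0) (D : ℕ → ℝ≥0) (S : Finset ι) : ℕ :=
  ((Finset.Icc 1 S.card).filter (fun l => ratio B D S l = blockPrice B D S)).sup id

/-- The bidders of the block. -/
def block (B : ι → ℝ≥0) (D : ℕ → ℝ≥0) (S : Finset ι) : Finset ι :=
  leaders B S (blockLength B D S)

/-! The price-setting mechanism. -/

/-- The number of bidders that are considered when the remaining bidders are `A`: the first `k`
such that the price for the `k` highest bidders is at least the next bid, if there is one. -/
def threshold (b B : ι → ℝ≥0) (D : ℕ → ℝ≥0) (A : Finset ι) : ℕ :=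
  sInf {k | 1 ≤ k ∧ ∀ j ∈ A, rank b A j = k → b j ≤ blockPrice B D (leaders b A k)}

/-- The budget of the threshold bidder `t` of `S`, reduced until the price is at most her bid. -/
def reducedBudget (b B : ι → ℝ≥0) (D : ℕ → ℝ≥0) (S : Finset ι) (t : ι) : ℝ≥0 :=
  sSup {x | x ≤ B t ∧ blockPrice (Function.update B t x) D S ≤ b t}

/-- The remaining bidders, the number of slots already allocated, and, for the bidders already
allocated, their clicks, their price, and the slots of their block. Bidders who never enter a
block have no clicks and price zero. -/
structure State (ι : Type*) where
  active : Finset ι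
  used : ℕ
  clicks : ι → ℝ≥0
  price : ι → ℝ≥0
  slots : ι → Set ℕ

open Classical in
/-- One round of the mechanism, on the remaining bidders and slots: the block is found and
allocated. Here `x / 0 = 0`, so that no clicks are given away at price zero. -/
def round (b B : ι → ℝ≥0) (D : ℕ → ℝ≥0) (s : State ι) : State ι :=
  let E : ℕ → ℝ≥0 := fun j => D (s.used + j)
  if s.active = ∅ ∨ ∀ j, E j = 0 then s else
    let k := threshold b B E s.active
    let S := leaders b s.active k
    let B' : ι → ℝ≥0 := fun i =>
      if i ∈ s.active ∧ rank b s.active i + 1 = k then reducedBudget b B E S i else B i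
    let p := blockPrice B' E S
    let l := blockLength B' E S
    let K := block B' E S
    { active := s.active \ K
      used := s.used + l
      clicks := fun i => if i ∈ K then B' i / p else s.clicks i
      price := fun i => if i ∈ K then p else s.price i
      slots := fun i => if i ∈ K then Set.Ico s.used (s.used + l) else s.slots i }

/-- The result of the price-setting mechanism. Every round allocates at least one bidder until
no bidder or no click remains, so the number of bidders bounds the number of rounds. -/
def priceSetting [Fintype ι] (b B : ι → ℝ≥0) (D : ℕ → ℝ≥0) : State ι :=
  (round b B D)^[Fintype.card ι]
    { active := Finset.univ
      used := 0
      clicks := fun _ => 0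
      price := fun _ => 0
      slots := fun _ => Set.univ }

/-- The slots, continued by dummy slots without clicks. -/
def pad {m : ℕ} (D : Fin m → ℝ≥0) (j : ℕ) : ℝ≥0 := if h : j < m then D ⟨j, h⟩ else 0

/-- `M` is the price-setting mechanism: under all declarations, the clicks and prices are the
computed ones, and the bidders of a block are scheduled in the slots of that block. (Only the
timetable within a block is left open.) -/
def Mechanism.IsPriceSetting [Fintype ι] {m : ℕ} {D : Fin m → ℝ≥0} (M : Mechanism ι D) : Prop :=
  ∀ (r : ι → Declaration) (i : ι),
    let s := priceSetting (fun j => (r j).bid) (fun j => (r j).budget) (pad D)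
    M.clicks r i = s.clicks i ∧ M.price r i = s.price i ∧
      ∀ a ∈ M.schedule r i, (a.slot : ℕ) ∈ s.slots i

end Ranking

end AdSlots

end

/-! The mechanism imitates a descending-price auction. Bidders join when the price falls to their
bid, those with equal bids one after the other in the tie order, and each raises her spending from
zero to her budget; at price `p` she demands her spending divided by `p`. Once a set of bidders
demands all clicks of the best free slots, the largest such set stops and takes them: this is a
block. `Time` orders the moments of this auction, so that joining bidders are told apart even at one
price.

A `Certificate` keeps what is left when the rounds are forgotten: everybody gets her demand at her
stop time, no set of `n` bidders gets more than the `n` best slots offer, and the bidders stopped by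
a stop time of positive price get exactly that much. The invariant `Progress` carries the rounds to
a certificate.

Monotonicity (`Certificate.clicks_mono`) compares two certificates. If a raised declaration cost its
bidder clicks, another bidder would have to gain and so to stop later; at her old stop time,
concavity of `window` contradicts the tightness of both outcomes.

Truthfulness reduces to monotonicity. An outcome that respects the true type stays certified when an
exaggerated budget or bid is cut back to the truth (`Certificate.truncate_budget`,
`Certificate.lower_bid`), so it is the outcome of a declaration below the truth. Only
`Certificate.lower_bid` needs the condition on ties.

As for schedules, the clicks in a block of positive price are majorized by the clicks of its slots.
By Rado's theorem they are a mixture of matchings, which can be run one after the other. -/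

noncomputable section

namespace AdSlots

/-! ### Rankings and leading bidders -/

section Order
variable {ι : Type*} [LinearOrder ι]

theorem Before.irrefl (v : ι → ℝ≥0) (i : ι) : ¬ Before v i i := by
  simp [Before]

theorem Before.trans {v : ι → ℝ≥0} {i j k : ι} (h : Before v i j) (h' : Before v j k) :
    Before v i k := by
  rcases h with h | ⟨h, g⟩ <;> rcases h' with h' | ⟨h', g'⟩
  · exact Or.inl (h'.trans h)
  · exact Or.inl (h' ▸ h)
  · exact Or.inl (h ▸ h')
  · exact Or.inr ⟨h.trans h', g.trans g'⟩

theorem before_or_eq_or_before (v : ι → ℝ≥0) (i j : ι) : Before v i j ∨ i = j ∨ Before v j i := by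
  unfold Before
  rcases lt_trichotomy (v i) (v j) with h | h | h
  · tauto
  · rcases lt_trichotomy i j with g | g | g <;> simp [h, g]
  · tauto

theorem Before.le {v : ι → ℝ≥0} {i j : ι} (h : Before v i j) : v j ≤ v i := by
  rcases h with h | h
  · exact h.le
  · exact h.1.ge

theorem rank_lt_rank_of_before {v : ι → ℝ≥0} {S : Finset ι} {i j : ι} (hi : i ∈ S)
    (h : Before v i j) : rank v S i < rank v S j := by
  apply Finset.card_lt_card
  refine Finset.ssubset_iff_subset_ne.2 ⟨?_, ?_⟩
  · intro k hk
    simp only [Finset.mem_filter] at hk ⊢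
    exact ⟨hk.1, hk.2.trans h⟩
  · intro he
    have : i ∈ S.filter (fun k => Before v k j) := by simp [hi, h]
    rw [← he] at this
    exact Before.irrefl v i (Finset.mem_filter.1 this).2

theorem rank_lt_rank_iff {v : ι → ℝ≥0} {S : Finset ι} {i j : ι} (hi : i ∈ S) (hj : j ∈ S) :
    rank v S i < rank v S j ↔ Before v i j := by
  refine ⟨fun h => ?_, rank_lt_rank_of_before hi⟩
  rcases before_or_eq_or_before v i j with g | g | g
  · exact g
  · exact absurd h (by simp [g])
  · exact absurd h (rank_lt_rank_of_before hj g).le.not_gt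

theorem rank_injOn (v : ι → ℝ≥0) (S : Finset ι) : Set.InjOn (rank v S) S := by
  intro i hi j hj h
  rcases before_or_eq_or_before v i j with g | g | g
  · exact absurd h (rank_lt_rank_of_before hi g).ne
  · exact g
  · exact absurd h (rank_lt_rank_of_before hj g).ne'

theorem rank_lt_card {v : ι → ℝ≥0} {S : Finset ι} {i : ι} (hi : i ∈ S) :
    rank v S i < S.card := by
  apply Finset.card_lt_card
  refine Finset.ssubset_iff_subset_ne.2 ⟨Finset.filter_subset _ _, fun he => ?_⟩
  rw [← he] at hi
  exact Before.irrefl v i (Finset.mem_filter.1 hi).2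

theorem image_rank (v : ι → ℝ≥0) (S : Finset ι) : S.image (rank v S) = Finset.range S.card := by
  apply Finset.eq_of_subset_of_card_le
  · intro n hn
    obtain ⟨i, hi, rfl⟩ := Finset.mem_image.1 hn
    exact Finset.mem_range.2 (rank_lt_card hi)
  · rw [Finset.card_range, Finset.card_image_of_injOn (rank_injOn v S)]

theorem exists_rank_eq (v : ι → ℝ≥0) {S : Finset ι} {n : ℕ} (hn : n < S.card) :
    ∃ i ∈ S, rank v S i = n := by
  have : n ∈ S.image (rank v S) := by rw [image_rank]; exact Finset.mem_range.2 hn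
  simpa using this

theorem leaders_subset (v : ι → ℝ≥0) (S : Finset ι) (l : ℕ) : leaders v S l ⊆ S :=
  Finset.filter_subset _ _

theorem mem_leaders {v : ι → ℝ≥0} {S : Finset ι} {l : ℕ} {i : ι} :
    i ∈ leaders v S l ↔ i ∈ S ∧ rank v S i < l := by
  simp [leaders]

theorem card_leaders (v : ι → ℝ≥0) {S : Finset ι} {l : ℕ} (hl : l ≤ S.card) :
    (leaders v S l).card = l := by
  rw [← Finset.card_image_of_injOn ((rank_injOn v S).mono (leaders_subset v S l))]
  have : (leaders v S l).image (rank v S) = Finset.range l := by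
    ext n
    simp only [Finset.mem_image, mem_leaders, Finset.mem_range]
    constructor
    · rintro ⟨i, ⟨_, h⟩, rfl⟩; exact h
    · intro h
      obtain ⟨i, hi, rfl⟩ := exists_rank_eq v (h.trans_le hl)
      exact ⟨i, ⟨hi, h⟩, rfl⟩
  rw [this, Finset.card_range]

/-- Outside their intersection the two sets have equally many members, and each member of `L \ T` is
ranked before each member of `T \ L`. -/
theorem sum_le_sum_leaders (v : ι → ℝ≥0) {S T : Finset ι} (hT : T ⊆ S) :
    ∑ i ∈ T, v i ≤ ∑ i ∈ leaders v S T.card, v i := by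
  set L := leaders v S T.card
  have hc : L.card = T.card := card_leaders v (Finset.card_le_card hT)
  have hc' : (T \ L).card = (L \ T).card := by
    have h1 := Finset.card_sdiff_add_card_inter T L
    have h2 := Finset.card_sdiff_add_card_inter L T
    rw [Finset.inter_comm] at h2
    omega
  rw [← Finset.sum_inter_add_sum_sdiff T L, ← Finset.sum_inter_add_sum_sdiff L T,
    Finset.inter_comm L T]
  gcongr _ + ?_
  rcases (L \ T).eq_empty_or_nonempty with h | h
  · have : T \ L = ∅ := by rw [← Finset.card_eq_zero, hc', h, Finset.card_empty]
    simp [this]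
  · obtain ⟨a, ha, hmin⟩ := Finset.exists_min_image _ v h
    calc ∑ i ∈ T \ L, v i ≤ (T \ L).card • v a := by
          apply Finset.sum_le_card_nsmul
          intro i hi
          rw [Finset.mem_sdiff] at hi ha
          have hai := mem_leaders.1 ha.1
          have : T.card ≤ rank v S i := by
            by_contra hlt
            exact hi.2 (mem_leaders.2 ⟨hT hi.1, not_le.1 hlt⟩)
          exact Before.le ((rank_lt_rank_iff hai.1 (hT hi.1)).1 (hai.2.trans_le this))
      _ = (L \ T).card • v a := by rw [hc']
      _ ≤ ∑ i ∈ L \ T, v i := Finset.card_nsmul_le_sum _ _ _ hmin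

end Order

/-! ### Find-Price-Block in terms of arbitrary sets of bidders -/

section Block
variable {ι : Type*} [LinearOrder ι]

/-- The number of clicks in the `n` slots that follow the first `u` slots. -/
def window (D : ℕ → ℝ≥0) (u n : ℕ) : ℝ≥0 := ∑ j ∈ Finset.range n, D (u + j)

theorem window_add (D : ℕ → ℝ≥0) (u a b : ℕ) :
    window D u (a + b) = window D u a + window D (u + a) b := by
  simp [window, Finset.sum_range_add, add_assoc]

theorem window_mono (D : ℕ → ℝ≥0) (u : ℕ) : Monotone (window D u) := by
  intro a b h
  exact Finset.sum_le_sum_of_subset (Finset.range_mono h)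

theorem window_anti {D : ℕ → ℝ≥0} (hD : Antitone D) {u u' : ℕ} (h : u ≤ u') (n : ℕ) :
    window D u' n ≤ window D u n :=
  Finset.sum_le_sum fun _ _ => hD (by omega)

theorem window_pos {D : ℕ → ℝ≥0} {u n : ℕ} (h : 0 < D u) (hn : 0 < n) : 0 < window D u n := by
  refine lt_of_lt_of_le ?_ (window_mono D u hn)
  simpa [window] using h

/-- Concavity of the number of clicks as a function of the number of slots. -/
theorem window_add_add_le {D : ℕ → ℝ≥0} (hD : Antitone D) (u a b n : ℕ) (h : a ≤ b) :
    window D u (b + n) + window D u a ≤ window D u b + window D u (a + n) := by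
  rw [window_add D u b n, window_add D u a n]
  have := window_anti hD (show u + a ≤ u + b by omega) n
  calc _ ≤ window D u b + window D (u + a) n + window D u a := by gcongr
    _ = _ := by ring

variable (B : ι → ℝ≥0) {D : ℕ → ℝ≥0} {u : ℕ} {S : Finset ι}

theorem ratio_eq_div_window (B : ι → ℝ≥0) (D : ℕ → ℝ≥0) (u : ℕ) (S : Finset ι) (l : ℕ) :
    ratio B (fun j => D (u + j)) S l = (∑ i ∈ leaders B S l, B i) / window D u l :=
  rfl

/-- The leaders have the largest budget sum among sets of their size, so the ratios control all
subsets. Later arguments can thus ignore the order of the budgets. -/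
theorem blockPrice_le_iff (h0 : 0 < D u) {q : ℝ≥0} :
    blockPrice B (fun j => D (u + j)) S ≤ q ↔
      ∀ T ⊆ S, ∑ i ∈ T, B i ≤ q * window D u T.card := by
  rw [blockPrice, Finset.sup_le_iff]
  constructor
  · intro h T hT
    rcases T.eq_empty_or_nonempty with rfl | hne
    · simp
    · have hpos : 0 < T.card := hne.card_pos
      have := h T.card (Finset.mem_Icc.2 ⟨hpos, Finset.card_le_card hT⟩)
      rw [ratio_eq_div_window, div_le_iff₀ (window_pos h0 hpos)] at this
      exact (sum_le_sum_leaders B hT).trans this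
  · intro h l hl
    rw [Finset.mem_Icc] at hl
    rw [ratio_eq_div_window, div_le_iff₀ (window_pos h0 hl.1)]
    have := h _ (leaders_subset B S l)
    rwa [card_leaders B hl.2] at this

theorem sum_le_blockPrice_mul (h0 : 0 < D u) {T : Finset ι} (hT : T ⊆ S) :
    ∑ i ∈ T, B i ≤ blockPrice B (fun j => D (u + j)) S * window D u T.card :=
  (blockPrice_le_iff B h0).1 le_rfl T hT

theorem block_subset (E : ℕ → ℝ≥0) (S : Finset ι) : block B E S ⊆ S := leaders_subset _ _ _

theorem blockLength_mem (E : ℕ → ℝ≥0) (hS : S.Nonempty) :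
    (1 ≤ blockLength B E S ∧ blockLength B E S ≤ S.card) ∧
      ratio B E S (blockLength B E S) = blockPrice B E S := by
  have hne : (Finset.Icc 1 S.card).Nonempty := ⟨1, by simpa using hS.card_pos⟩
  obtain ⟨l, hl, hle⟩ := Finset.exists_mem_eq_sup _ hne (ratio B E S)
  have hf : ((Finset.Icc 1 S.card).filter
      (fun l => ratio B E S l = blockPrice B E S)).Nonempty :=
    ⟨l, Finset.mem_filter.2 ⟨hl, hle.symm⟩⟩
  obtain ⟨l', hl', hle'⟩ := Finset.exists_mem_eq_sup _ hf id
  have : blockLength B E S = l' := hle'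
  rw [this]
  simpa using hl'

theorem card_block (E : ℕ → ℝ≥0) (hS : S.Nonempty) :
    (block B E S).card = blockLength B E S :=
  card_leaders B (blockLength_mem B E hS).1.2

theorem block_nonempty (E : ℕ → ℝ≥0) (hS : S.Nonempty) : (block B E S).Nonempty := by
  rw [← Finset.card_pos, card_block B E hS]
  exact (blockLength_mem B E hS).1.1

theorem sum_block (h0 : 0 < D u) (hS : S.Nonempty) :
    ∑ i ∈ block B (fun j => D (u + j)) S, B i =
      blockPrice B (fun j => D (u + j)) S *
        window D u (block B (fun j => D (u + j)) S).card := by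
  have h := blockLength_mem B (fun j => D (u + j)) hS
  rw [card_block B _ hS, ← h.2, ratio_eq_div_window]
  exact (div_mul_cancel₀ _ (window_pos h0 h.1.1).ne').symm

theorem sum_lt_of_card_block_lt (h0 : 0 < D u) (hS : S.Nonempty) {T : Finset ι} (hT : T ⊆ S)
    (hc : (block B (fun j => D (u + j)) S).card < T.card) :
    ∑ i ∈ T, B i < blockPrice B (fun j => D (u + j)) S * window D u T.card := by
  rw [card_block B _ hS] at hc
  have hpos : 0 < T.card := by omega
  have hmem : T.card ∈ Finset.Icc 1 S.card :=
    Finset.mem_Icc.2 ⟨hpos, Finset.card_le_card hT⟩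
  have hle : ratio B (fun j => D (u + j)) S T.card ≤ blockPrice B (fun j => D (u + j)) S :=
    Finset.le_sup hmem
  have hlt : ratio B (fun j => D (u + j)) S T.card < blockPrice B (fun j => D (u + j)) S := by
    refine lt_of_le_of_ne hle fun he => hc.not_ge ?_
    exact Finset.le_sup (f := id) (Finset.mem_filter.2 ⟨hmem, he⟩)
  rw [ratio_eq_div_window, div_lt_iff₀ (window_pos h0 hpos)] at hlt
  exact (sum_le_sum_leaders B hT).trans_lt hlt

/-- Strict because the block is the longest one attaining the price. This strictness is what makes
stop times increase from round to round. -/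
theorem sum_sdiff_block_lt (h0 : 0 < D u) (hS : S.Nonempty) {R : Finset ι}
    (hR : R ⊆ S \ block B (fun j => D (u + j)) S) (hne : R.Nonempty) :
    ∑ i ∈ R, B i < blockPrice B (fun j => D (u + j)) S *
      window D (u + (block B (fun j => D (u + j)) S).card) R.card := by
  set K := block B (fun j => D (u + j)) S with hK
  have hd : Disjoint K R := by
    rw [Finset.disjoint_left]
    intro i hi hi'
    exact (Finset.mem_sdiff.1 (hR hi')).2 hi
  have hc : (K ∪ R).card = K.card + R.card := Finset.card_union_of_disjoint hd
  have hsub : K ∪ R ⊆ S := Finset.union_subset (block_subset B _ S)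
    (hR.trans Finset.sdiff_subset)
  have := sum_lt_of_card_block_lt B h0 hS hsub (by have := hne.card_pos; rw [← hK]; omega)
  rw [Finset.sum_union hd, hc, window_add, mul_add, sum_block B h0 hS] at this
  exact lt_of_add_lt_add_left this

/-- A set that attains the price of the block is contained in the block. -/
theorem subset_block_of_sum_eq (hD : Antitone D) (h0 : 0 < D u) (hS : S.Nonempty) {T : Finset ι}
    (hT : T ⊆ S)
    (he : ∑ i ∈ T, B i = blockPrice B (fun j => D (u + j)) S * window D u T.card) :
    T ⊆ block B (fun j => D (u + j)) S := by
  set K := block B (fun j => D (u + j)) S with hK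
  by_contra hsub
  have hne : (T \ K).Nonempty := by rwa [Finset.sdiff_nonempty]
  have h1 := sum_sdiff_block_lt B h0 hS (R := T \ K) (Finset.sdiff_subset_sdiff hT le_rfl) hne
  rw [← hK] at h1
  have h2 := sum_le_blockPrice_mul B h0 (T := T ∩ K) (Finset.inter_subset_left.trans hT)
  have hc := Finset.card_sdiff_add_card_inter T K
  have h3 : window D (u + K.card) (T \ K).card ≤ window D (u + (T ∩ K).card) (T \ K).card :=
    window_anti hD (by have := Finset.card_le_card (Finset.inter_subset_right : T ∩ K ⊆ K); omega) _
  refine he.not_lt ?_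
  rw [← Finset.sum_inter_add_sum_sdiff T K, ← hc, add_comm (T \ K).card, window_add, mul_add]
  exact add_lt_add_of_le_of_lt h2 (h1.trans_le (by gcongr))

end Block

/-! ### What one round achieves -/

section Round
variable {ι : Type*} [LinearOrder ι]

theorem threshold_mem (b B : ι → ℝ≥0) (E : ℕ → ℝ≥0) {A : Finset ι} (hA : A.Nonempty) :
    1 ≤ threshold b B E A ∧ ∀ j ∈ A, rank b A j = threshold b B E A →
      b j ≤ blockPrice B E (leaders b A (threshold b B E A)) := by
  refine Nat.sInf_mem (s := {k | 1 ≤ k ∧ ∀ j ∈ A, rank b A j = k →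
    b j ≤ blockPrice B E (leaders b A k)}) ⟨A.card, hA.card_pos, fun j hj h => ?_⟩
  exact absurd h (rank_lt_card hj).ne

theorem threshold_le_card (b B : ι → ℝ≥0) (E : ℕ → ℝ≥0) {A : Finset ι} (hA : A.Nonempty) :
    threshold b B E A ≤ A.card :=
  Nat.sInf_le ⟨hA.card_pos, fun _ hj h => absurd h (rank_lt_card hj).ne⟩

theorem blockPrice_lt_of_lt_threshold {b B : ι → ℝ≥0} {E : ℕ → ℝ≥0} {A : Finset ι} {n : ℕ}
    (hn : 1 ≤ n) (h : n < threshold b B E A) {t : ι} (ht : t ∈ A) (hr : rank b A t = n) :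
    blockPrice B E (leaders b A n) < b t := by
  by_contra hlt
  refine Nat.notMem_of_lt_sInf h ⟨hn, fun j hj hjr => ?_⟩
  rw [rank_injOn b A hj ht (hjr.trans hr.symm)]
  exact not_lt.1 hlt

/-- Given `H`, the price stays below `b t` exactly when the budget of `t` is at most the slack of
every set containing `t`. These are finitely many closed conditions, so the supremum is attained,
and it equals the old budget unless some condition is tight. -/
theorem reducedBudget_spec {b B : ι → ℝ≥0} {D : ℕ → ℝ≥0} {u : ℕ} {S : Finset ι} {t : ι}
    (h0 : 0 < D u)
    (H : ∀ T ⊆ S.erase t, ∑ i ∈ T, B i ≤ b t * window D u T.card) :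
    let x := reducedBudget b B (fun j => D (u + j)) S t
    x ≤ B t ∧ blockPrice (Function.update B t x) (fun j => D (u + j)) S ≤ b t ∧
      (x = B t ∨ ∃ T ⊆ S, t ∈ T ∧
        ∑ i ∈ T, Function.update B t x i = b t * window D u T.card) := by
  intro x
  set slack : Finset ι → ℝ≥0 := fun T => b t * window D u T.card - ∑ i ∈ T \ {t}, B i
  have hsl : ∀ T ⊆ S, ∑ i ∈ T \ {t}, B i ≤ b t * window D u T.card := by
    intro T hT
    refine (H (T \ {t}) ?_).trans ?_
    · rw [← Finset.sdiff_singleton_eq_erase]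
      exact Finset.sdiff_subset_sdiff hT le_rfl
    · gcongr
      exact window_mono D u (Finset.card_le_card Finset.sdiff_subset)
  have hiff : ∀ y, blockPrice (Function.update B t y) (fun j => D (u + j)) S ≤ b t ↔
      ∀ T ⊆ S, t ∈ T → y ≤ slack T := by
    intro y
    rw [blockPrice_le_iff _ h0]
    constructor
    · intro h T hT htT
      have := h T hT
      rw [Finset.sum_update_of_mem htT] at this
      exact le_tsub_of_add_le_right this
    · intro h T hT
      by_cases htT : t ∈ T
      · rw [Finset.sum_update_of_mem htT]
        exact (le_tsub_iff_right (hsl T hT)).1 (h T hT htT)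
      · rw [Finset.sum_update_of_notMem htT]
        have := hsl T hT
        rwa [Finset.sdiff_singleton_eq_erase, Finset.erase_eq_of_notMem htT] at this
  have hx : x = sSup {y | y ≤ B t ∧ ∀ T ⊆ S, t ∈ T → y ≤ slack T} := by
    simp only [x, reducedBudget, hiff]
  set Y := {y | y ≤ B t ∧ ∀ T ⊆ S, t ∈ T → y ≤ slack T} with hY
  have hYne : Y.Nonempty := ⟨0, by simp [hY]⟩
  have hYbdd : BddAbove Y := ⟨B t, fun y hy => hy.1⟩
  have hxY : x ∈ Y := by
    rw [hx]
    exact ⟨csSup_le hYne fun y hy => hy.1,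
      fun T hT htT => csSup_le hYne fun y hy => hy.2 T hT htT⟩
  refine ⟨hxY.1, (hiff x).2 hxY.2, ?_⟩
  by_cases htight : ∃ T ⊆ S, t ∈ T ∧ x = slack T
  · obtain ⟨T, hT, htT, he⟩ := htight
    refine Or.inr ⟨T, hT, htT, ?_⟩
    rw [Finset.sum_update_of_mem htT, he]
    exact tsub_add_cancel_of_le (hsl T hT)
  · left
    push Not at htight
    by_contra hne
    -- If no bound were attained, the least of them would be an admissible value above `x`.
    -- Inserting `{t}` keeps the index set nonempty without assuming `t ∈ S`.
    obtain ⟨T, hT, hmin⟩ := Finset.exists_min_image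
      (insert {t} (S.powerset.filter (fun T => t ∈ T)))
      (fun T => if T ⊆ S then min (B t) (slack T) else B t) ⟨{t}, by simp⟩
    set y := if T ⊆ S then min (B t) (slack T) else B t with hy
    have hTt : t ∈ T := by
      rcases Finset.mem_insert.1 hT with rfl | h
      · simp
      · exact (Finset.mem_filter.1 h).2
    have hlt : x < y := by
      rw [hy]
      have hB := lt_of_le_of_ne hxY.1 hne
      split_ifs with hTS
      · exact lt_min hB (lt_of_le_of_ne (hxY.2 T hTS hTt) (htight T hTS hTt))
      · exact hB
    have hyY : y ∈ Y := by
      refine ⟨?_, fun T' hT' htT' => ?_⟩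
      · rw [hy]; split_ifs
        · exact min_le_left _ _
        · exact le_rfl
      · have := hmin T' (by simp [hT', htT'])
        rw [if_pos hT'] at this
        exact this.trans (min_le_right _ _)
    exact hlt.not_ge (hx ▸ le_csSup hYbdd hyY)

/-- The outcome of one round for the remaining bidders `A` if `u` slots have been used: the block
`K` is chosen from the considered bidders `S`, the last of whom is `t`, at price `p`, with the
budgets `B'`. -/
structure IsRound (b B : ι → ℝ≥0) (D : ℕ → ℝ≥0) (A : Finset ι) (u : ℕ) (S : Finset ι) (t : ι)
    (B' : ι → ℝ≥0) (p : ℝ≥0) (K : Finset ι) : Prop where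
  subset : S ⊆ A
  block_subset : K ⊆ S
  block_nonempty : K.Nonempty
  threshold_mem : t ∈ S
  before_threshold : ∀ j ∈ S, j = t ∨ Before b j t
  threshold_before : ∀ j ∈ A, j ∉ S → Before b t j
  budget_eq : ∀ j, j ≠ t → B' j = B j
  budget_le : B' t ≤ B t
  price_le : p ≤ b t
  le_price : ∀ j ∈ A, j ∉ S → b j ≤ p
  reduced : B' t = B t ∨ p = b t ∧ t ∈ K
  sum_le : ∀ T ⊆ S, ∑ i ∈ T, B' i ≤ p * window D u T.card
  sum_block : ∑ i ∈ K, B' i = p * window D u K.card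
  sum_lt : ∀ R ⊆ S \ K, R.Nonempty → ∑ i ∈ R, B' i < p * window D (u + K.card) R.card

theorem round_of_done {b B : ι → ℝ≥0} {D : ℕ → ℝ≥0} {s : State ι}
    (h : s.active = ∅ ∨ ∀ j, D (s.used + j) = 0) : round b B D s = s := by
  simp only [round, if_pos h]

/-- The state after a round. -/
def State.allocate (s : State ι) (K : Finset ι) (B' : ι → ℝ≥0) (p : ℝ≥0) :
    State ι where
  active := s.active \ K
  used := s.used + K.card
  clicks := fun i => if i ∈ K then B' i / p else s.clicks i
  price := fun i => if i ∈ K then p else s.price i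
  slots := fun i => if i ∈ K then Set.Ico s.used (s.used + K.card) else s.slots i

/-- Minimality of the threshold bounds the price without the last bidder `t` by `b t`, so lowering
her budget alone suffices. If it is lowered, some set containing her is tight at price `b t`, which
puts her into the block. -/
theorem exists_isRound (b B : ι → ℝ≥0) {D : ℕ → ℝ≥0} (hD : Antitone D) {s : State ι}
    (hA : s.active.Nonempty) (h0 : 0 < D s.used) :
    ∃ S t B' p K, IsRound b B D s.active s.used S t B' p K ∧
      round b B D s = s.allocate K B' p := by
  set A := s.active
  set E : ℕ → ℝ≥0 := fun j => D (s.used + j)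
  set k := threshold b B E A
  set S := leaders b A k
  have hk1 : 1 ≤ k := (threshold_mem b B E hA).1
  have hkc : k ≤ A.card := threshold_le_card b B E hA
  obtain ⟨t, htA, htr⟩ := exists_rank_eq b (show k - 1 < A.card by omega)
  have htS : t ∈ S := mem_leaders.2 ⟨htA, by omega⟩
  have hSA : S ⊆ A := leaders_subset _ _ _
  set x := reducedBudget b B E S t
  set B' := Function.update B t x with hB'
  have hB'eq : (fun i => if i ∈ A ∧ rank b A i + 1 = k then reducedBudget b B E S i else B i) =
      B' := by
    funext i
    by_cases hi : i = t
    · subst hi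
      rw [if_pos ⟨htA, by omega⟩, hB', Function.update_self]
    · rw [if_neg, hB', Function.update_of_ne hi]
      rintro ⟨h1, h2⟩
      exact hi (rank_injOn b A h1 htA (by omega))
  have hSne : S.Nonempty := ⟨t, htS⟩
  set p := blockPrice B' E S with hp
  set K := block B' E S
  have hbefore : ∀ j ∈ S, j = t ∨ Before b j t := by
    intro j hj
    have hj' := mem_leaders.1 hj
    rcases before_or_eq_or_before b j t with h | h | h
    · exact Or.inr h
    · exact Or.inl h
    · have := (rank_lt_rank_iff htA hj'.1).2 h
      omega
  have hafter : ∀ j ∈ A, j ∉ S → k ≤ rank b A j := by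
    intro j hj hjS
    by_contra h
    exact hjS (mem_leaders.2 ⟨hj, by omega⟩)
  have herase : S.erase t = leaders b A (k - 1) := by
    ext j
    rw [Finset.mem_erase, mem_leaders, mem_leaders]
    constructor
    · rintro ⟨h1, h2, h3⟩
      refine ⟨h2, ?_⟩
      have : rank b A j ≠ rank b A t := fun h => h1 (rank_injOn b A h2 htA h)
      omega
    · rintro ⟨h1, h2⟩
      exact ⟨by rintro rfl; omega, h1, by omega⟩
  have H : ∀ T ⊆ S.erase t, ∑ i ∈ T, B i ≤ b t * window D s.used T.card := by
    intro T hT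
    rcases Nat.lt_or_ge 1 k with h1 | h1
    · have hlt := blockPrice_lt_of_lt_threshold (b := b) (B := B) (E := E) (n := k - 1)
        (by omega) (by omega) htA htr
      rw [← herase] at hlt
      exact (blockPrice_le_iff B h0).1 hlt.le T hT
    -- Minimality says nothing for `k = 1`, but then nobody is left besides `t`.
    · have : T = ∅ := by
        rw [← Finset.subset_empty]
        intro j hj
        have := hT hj
        rw [herase, mem_leaders] at this
        omega
      simp [this]
  obtain ⟨hxB, hxp, hxor⟩ := reducedBudget_spec h0 H
  have hredu : B' t = B t ∨ p = b t ∧ t ∈ K := by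
    rcases hxor with h | ⟨T, hT, htT, hsum⟩
    · left; rw [hB', Function.update_self]; exact h
    · right
      have hT1 : 0 < T.card := Finset.card_pos.2 ⟨t, htT⟩
      have hle := sum_le_blockPrice_mul B' h0 hT
      change ∑ i ∈ T, B' i = _ at hsum
      rw [hsum] at hle
      have hpb : p = b t :=
        le_antisymm hxp (le_of_mul_le_mul_right hle (window_pos h0 hT1))
      refine ⟨hpb, subset_block_of_sum_eq B' hD h0 hSne hT ?_ htT⟩
      rw [hsum, ← hpb]
  have hlep : ∀ j ∈ A, j ∉ S → b j ≤ p := by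
    intro j hj hjS
    have hjr := hafter j hj hjS
    rcases hredu with h | h
    · have hBB : B' = B := by
        rw [hB', Function.update_eq_self_iff]
        rw [hB', Function.update_self] at h
        exact h
      obtain ⟨j', hj', hjr'⟩ := exists_rank_eq b (hjr.trans_lt (rank_lt_card hj))
      have h1 : b j' ≤ p := by
        rw [hp, hBB]
        exact (threshold_mem b B E hA).2 j' hj' hjr'
      rcases hjr.lt_or_eq with h2 | h2
      · exact (Before.le ((rank_lt_rank_iff hj' hj).1 (by omega))).trans h1
      · rwa [rank_injOn b A hj hj' (by omega)]
    · rw [h.1]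
      exact Before.le ((rank_lt_rank_iff htA hj).1 (by omega))
  have hKc : K.card = blockLength B' E S := card_block B' E hSne
  refine ⟨S, t, B', p, K, ?_, ?_⟩
  · exact
      { subset := hSA
        block_subset := block_subset B' E S
        block_nonempty := block_nonempty B' E hSne
        threshold_mem := htS
        before_threshold := hbefore
        threshold_before := fun j hj hjS =>
          (rank_lt_rank_iff htA hj).1 (by have := hafter j hj hjS; omega)
        budget_eq := fun j hj => Function.update_of_ne hj _ _
        budget_le := by rw [hB', Function.update_self]; exact hxB
        price_le := hxp
        le_price := hlep
        reduced := hredu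
        sum_le := fun T hT => sum_le_blockPrice_mul B' h0 hT
        sum_block := sum_block B' h0 hSne
        sum_lt := fun R hR hne => sum_sdiff_block_lt B' h0 hSne hR hne }
  · have hnot : ¬ (s.active = ∅ ∨ ∀ j, D (s.used + j) = 0) := by
      rintro (h | h)
      · exact hA.ne_empty h
      · exact h0.ne' (h 0)
    have hBk : (fun i => if i ∈ s.active ∧ rank b s.active i + 1 =
        threshold b B (fun j => D (s.used + j)) s.active then
          reducedBudget b B (fun j => D (s.used + j)) (leaders b s.active
            (threshold b B (fun j => D (s.used + j)) s.active)) i else B i) = B' := by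
      rw [← hB'eq]
    simp only [round, if_neg hnot, State.allocate]
    rw [hKc]
    have hBi := congrFun hBk
    simp only [hBi]
    rfl

end Round

/-! ### Moments of the descending-price auction, spending and demand -/

section Time

/-- The moments of a descending-price auction: the price falls, and at each price the bidders
with exactly that bid join one after the other, each raising her spending from zero. -/
abbrev Time (ι : Type*) : Type _ := ℝ≥0ᵒᵈ ×ₗ WithBot (ι ×ₗ ℝ≥0)

variable {ι : Type*}

/-- The moment at which the price `p` is reached, before bidders with bid `p` join. -/
def early (ι : Type*) (p : ℝ≥0) : Time ι := toLex (OrderDual.toDual p, ⊥)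

/-- The moment at which bidder `k` with bid `p` has joined with the part `x` of her budget. -/
def late (p : ℝ≥0) (k : ι) (x : ℝ≥0) : Time ι :=
  toLex (OrderDual.toDual p, ((toLex (k, x) : ι ×ₗ ℝ≥0) : WithBot (ι ×ₗ ℝ≥0)))

/-- The price at a moment. -/
def timePrice (t : Time ι) : ℝ≥0 := OrderDual.ofDual (ofLex t).1

theorem timePrice_early (p : ℝ≥0) : timePrice (early ι p) = p := rfl

theorem early_or_late (t : Time ι) :
    t = early ι (timePrice t) ∨ ∃ k x, t = late (timePrice t) k x := by
  obtain ⟨p, o⟩ := t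
  cases o with
  | bot => exact Or.inl rfl
  | coe a => exact Or.inr ⟨a.1, a.2, rfl⟩

variable [LinearOrder ι]

theorem le_iff_timePrice {t t' : Time ι} :
    t ≤ t' ↔ timePrice t' < timePrice t ∨
      timePrice t = timePrice t' ∧ (ofLex t).2 ≤ (ofLex t').2 :=
  Prod.Lex.le_iff

theorem timePrice_le_of_le {t t' : Time ι} (h : t ≤ t') : timePrice t' ≤ timePrice t := by
  rcases le_iff_timePrice.1 h with h | h
  · exact h.le
  · exact h.1.ge

theorem lt_of_timePrice_lt {t t' : Time ι} (h : timePrice t' < timePrice t) : t < t' :=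
  Prod.Lex.lt_iff.2 (Or.inl h)

theorem early_le_iff {p : ℝ≥0} {t : Time ι} : early ι p ≤ t ↔ timePrice t ≤ p := by
  rw [le_iff_timePrice, timePrice_early, le_iff_lt_or_eq (a := timePrice t)]
  refine or_congr_right ⟨fun h => h.1.symm, fun h => ⟨h.symm, bot_le⟩⟩

theorem late_le_early {b p y : ℝ≥0} {j : ι} : late b j y ≤ early ι p ↔ p < b := by
  rw [early, late, Prod.Lex.toLex_le_toLex]
  simp

theorem late_le_late {b p y x : ℝ≥0} {j k : ι} :
    late b j y ≤ late p k x ↔ p < b ∨ b = p ∧ (j < k ∨ j = k ∧ y ≤ x) := by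
  rw [late, late, Prod.Lex.toLex_le_toLex]
  simp [Prod.Lex.toLex_le_toLex]

theorem late_le_of_timePrice_lt {b y : ℝ≥0} {j : ι} {t : Time ι} (h : timePrice t < b) :
    late b j y ≤ t :=
  (lt_of_timePrice_lt h).le

/-- The largest amount that a bidder with bid `b` and budget `B` has joined with. -/
def spend (b B : ℝ≥0) (j : ι) (t : Time ι) : ℝ≥0 := sSup {y | y ≤ B ∧ late b j y ≤ t}

theorem spend_le_budget (b B : ℝ≥0) (j : ι) (t : Time ι) : spend b B j t ≤ B :=
  csSup_le' fun _ hy => hy.1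

theorem le_spend {b B y : ℝ≥0} {j : ι} {t : Time ι} (hy : y ≤ B) (h : late b j y ≤ t) :
    y ≤ spend b B j t :=
  le_csSup ⟨B, fun _ hz => hz.1⟩ ⟨hy, h⟩

theorem late_anti {b b' y : ℝ≥0} {j : ι} (h : b ≤ b') : late b' j y ≤ late b j y := by
  rw [late_le_late]
  rcases h.lt_or_eq with h | h
  · exact Or.inl h
  · exact Or.inr ⟨h.symm, Or.inr ⟨rfl, le_rfl⟩⟩

theorem spend_mono {b b' B B' : ℝ≥0} {j : ι} {t t' : Time ι} (hb : b ≤ b') (hB : B ≤ B')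
    (ht : t ≤ t') : spend b B j t ≤ spend b' B' j t' :=
  csSup_le' fun _ hy => le_spend (hy.1.trans hB) ((late_anti hb).trans (hy.2.trans ht))

theorem spend_eq_budget {b B : ℝ≥0} {j : ι} {t : Time ι} (h : late b j B ≤ t) :
    spend b B j t = B :=
  le_antisymm (spend_le_budget b B j t) (le_spend le_rfl h)

theorem spend_late_self {b B x : ℝ≥0} {j : ι} (hx : x ≤ B) : spend b B j (late b j x) = x := by
  refine le_antisymm (csSup_le' fun y hy => ?_) (le_spend hx le_rfl)
  simpa using late_le_late.1 hy.2

theorem late_mono {b y y' : ℝ≥0} {j : ι} (h : y ≤ y') : late b j y ≤ late b j y' :=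
  late_le_late.2 (Or.inr ⟨rfl, Or.inr ⟨rfl, h⟩⟩)

theorem spend_eq_zero {b B : ℝ≥0} {j : ι} {t : Time ι} (h : ¬ late b j 0 ≤ t) :
    spend b B j t = 0 := by
  have : {y | y ≤ B ∧ late b j y ≤ t} = ∅ := by
    ext y
    simp only [Set.mem_ofPred_eq, Set.mem_empty_iff_false, iff_false, not_and]
    exact fun _ hy => h ((late_mono zero_le).trans hy)
  rw [spend, this, csSup_empty]
  rfl

theorem spend_congr_budget {b B B' : ℝ≥0} {j : ι} {t : Time ι} (h : B' ≤ B)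
    (hs : spend b B j t ≤ B') : spend b B' j t = spend b B j t :=
  le_antisymm (spend_mono le_rfl h le_rfl)
    (csSup_le' fun _ hy => le_spend ((le_spend hy.1 hy.2).trans hs) hy.2)

theorem timePrice_le_of_spend_pos {b B : ℝ≥0} {j : ι} {t : Time ι} (h : 0 < spend b B j t) :
    timePrice t ≤ b := by
  by_contra hlt
  exact h.ne' (spend_eq_zero fun hle => hlt (timePrice_le_of_le hle))

/-- The number of clicks demanded at time `t`. -/
def demand (b B : ℝ≥0) (j : ι) (t : Time ι) : ℝ≥0 := spend b B j t / timePrice t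

theorem demand_eq_zero {b B : ℝ≥0} {j : ι} {t : Time ι} (h : B = 0 ∨ b = 0) :
    demand b B j t = 0 := by
  rw [demand, div_eq_zero_iff]
  by_contra hne
  push Not at hne
  rcases h with rfl | rfl
  · exact hne.1 (le_antisymm (spend_le_budget _ _ _ _) zero_le)
  · exact hne.2 (le_antisymm (timePrice_le_of_spend_pos (pos_iff_ne_zero.2 hne.1)) zero_le)

/-- Later, more has been spent and the price is lower. The last hypothesis covers price zero, where
division gives demand `0`. -/
theorem demand_mono {b b' B B' : ℝ≥0} {j : ι} {t t' : Time ι} (hb : b ≤ b') (hB : B ≤ B')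
    (ht : t ≤ t') (h : timePrice t' = 0 → B' = 0 ∨ b' = 0) :
    demand b B j t ≤ demand b' B' j t' := by
  rcases eq_or_ne (timePrice t') 0 with h0 | h0
  · rw [demand_eq_zero]
    · exact zero_le
    · rcases h h0 with rfl | rfl
      · exact Or.inl (le_antisymm hB zero_le)
      · exact Or.inr (le_antisymm hb zero_le)
  · exact div_le_div₀ zero_le (spend_mono hb hB ht) (pos_iff_ne_zero.2 h0)
      (timePrice_le_of_le ht)

/-- `c` is the outcome of the descending-price auction in which bidder `j` stops at time
`τ j`. -/
structure Certificate [Fintype ι] (D : ℕ → ℝ≥0) (b B : ι → ℝ≥0) (c : ι → ℝ≥0) (τ : ι → Time ι) :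
    Prop where
  feasible : ∀ T : Finset ι, ∑ j ∈ T, c j ≤ window D 0 T.card
  clicks_eq : ∀ j, c j = demand (b j) (B j) j (τ j)
  tight : ∀ l, 0 < timePrice (τ l) →
    ∑ j ∈ Finset.univ.filter (fun j => τ j ≤ τ l), c j =
      window D 0 (Finset.univ.filter (fun j => τ j ≤ τ l)).card
  of_timePrice_eq_zero : ∀ l, timePrice (τ l) = 0 → B l = 0 ∨ b l = 0

/-! ### Comparing and modifying certified outcomes -/

namespace Certificate
variable [Fintype ι] {D : ℕ → ℝ≥0} {b b' B B' c c' : ι → ℝ≥0} {τ τ' : ι → Time ι}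

theorem tight_of_time (h : Certificate D b B c τ) {t : Time ι} (ht : 0 < timePrice t) :
    ∑ j ∈ Finset.univ.filter (fun j => τ j ≤ t), c j =
      window D 0 (Finset.univ.filter (fun j => τ j ≤ t)).card := by
  rcases (Finset.univ.filter (fun j => τ j ≤ t)).eq_empty_or_nonempty with he | hne
  · rw [he]; simp [window]
  · obtain ⟨l, hl, hmax⟩ := Finset.exists_max_image _ τ hne
    have hlt := (Finset.mem_filter.1 hl).2
    have : Finset.univ.filter (fun j => τ j ≤ t) = Finset.univ.filter (fun j => τ j ≤ τ l) := by
      ext j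
      simp only [Finset.mem_filter, Finset.mem_univ, true_and]
      exact ⟨fun hj => hmax j (by simpa using hj), fun hj => hj.trans hlt⟩
    rw [this]
    exact h.tight l (ht.trans_le (timePrice_le_of_le hlt))

/-- The clicks of a bidder are monotone in her own declaration. -/
theorem clicks_mono (hD : Antitone D) (h : Certificate D b B c τ)
    (h' : Certificate D b' B' c' τ') {i : ι} (hb : ∀ j, j ≠ i → b j = b' j)
    (hB : ∀ j, j ≠ i → B j = B' j) (hbi : b i ≤ b' i) (hBi : B i ≤ B' i) : c i ≤ c' i := by
  have hb' : ∀ j, b j ≤ b' j := fun j => by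
    by_cases hj : j = i
    · rw [hj]; exact hbi
    · exact (hb j hj).le
  have hB' : ∀ j, B j ≤ B' j := fun j => by
    by_cases hj : j = i
    · rw [hj]; exact hBi
    · exact (hB j hj).le
  have hmono : ∀ j, τ j ≤ τ' j → c j ≤ c' j := fun j hj => by
    rw [h.clicks_eq, h'.clicks_eq]
    exact demand_mono (hb' j) (hB' j) hj (h'.of_timePrice_eq_zero j)
  have hmono' : ∀ j, j ≠ i → τ' j ≤ τ j → c' j ≤ c j := fun j hji hj => by
    rw [h.clicks_eq, h'.clicks_eq, ← hb j hji, ← hB j hji]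
    exact demand_mono le_rfl le_rfl hj (h.of_timePrice_eq_zero j)
  by_contra hlt
  rw [not_le] at hlt
  have hp : 0 < timePrice (τ' i) := by
    rw [pos_iff_ne_zero]
    intro h0
    refine (zero_le.trans_lt hlt).ne' ?_
    rw [h.clicks_eq]
    apply demand_eq_zero
    rcases h'.of_timePrice_eq_zero i h0 with g | g
    · exact Or.inl (le_antisymm (g ▸ hBi) zero_le)
    · exact Or.inr (le_antisymm (g ▸ hbi) zero_le)
  -- Otherwise the set that is tight for `c'` would get strictly more under `c`, against
  -- feasibility.
  obtain ⟨j, hjT, hj⟩ : ∃ j ∈ Finset.univ.filter (fun j => τ' j ≤ τ' i), c j < c' j := by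
    by_contra! hle
    have := Finset.sum_lt_sum hle ⟨i, by simp, hlt⟩
    rw [h'.tight i hp] at this
    exact this.not_ge (h.feasible _)
  have hji : j ≠ i := by rintro rfl; exact hlt.not_gt hj
  have hjτ : τ j < τ' j := by
    by_contra hle
    exact hj.not_ge (hmono' j hji (not_lt.1 hle))
  have hpj : 0 < timePrice (τ j) :=
    hp.trans_le ((timePrice_le_of_le (Finset.mem_filter.1 hjT).2).trans
      (timePrice_le_of_le hjτ.le))
  -- At the old stop time of `j`, both outcomes are tight on the bidders they have stopped. Those in
  -- `T \ F` stop later under `τ'`, so none of them loses, and `j` gains.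
  set T := Finset.univ.filter (fun l => τ l ≤ τ j) with hT
  set F := Finset.univ.filter (fun l => τ' l ≤ τ j) with hF
  have hTt : ∑ l ∈ T, c l = window D 0 T.card := h.tight j hpj
  have hFt : ∑ l ∈ F, c' l = window D 0 F.card := h'.tight_of_time hpj
  have hsd : ∑ l ∈ T \ F, c l < ∑ l ∈ T \ F, c' l := by
    refine Finset.sum_lt_sum (fun l hl => hmono l ?_) ⟨j, by simp [hT, hF, hjτ], hj⟩
    simp only [hT, hF, Finset.mem_sdiff, Finset.mem_filter, Finset.mem_univ, true_and,
      not_le] at hl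
    exact hl.1.trans hl.2.le
  have hU := h'.feasible (F ∪ T)
  rw [← Finset.union_sdiff_self_eq_union, Finset.sum_union Finset.disjoint_sdiff,
    Finset.card_union_of_disjoint Finset.disjoint_sdiff, hFt] at hU
  have hI := h.feasible (T ∩ F)
  have hc := Finset.card_sdiff_add_card_inter T F
  -- Under `c'`, `T \ F` gets at most the increment of `window` from `F` to `F ∪ T`; under `c`, at
  -- least the increment from `T ∩ F` to `T`. By concavity the former is no larger, so the gain is
  -- impossible.
  have hconc := window_add_add_le hD 0 (T ∩ F).card F.card (T \ F).card
    (Finset.card_le_card Finset.inter_subset_right)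
  rw [add_comm (T ∩ F).card, hc] at hconc
  have hs := Finset.sum_inter_add_sum_sdiff T F c
  rw [hTt] at hs
  simp only [← NNReal.coe_le_coe, ← NNReal.coe_lt_coe, ← NNReal.coe_inj, NNReal.coe_add]
    at hU hI hconc hs hsd
  linarith

/-- A bidder whose payment is within a smaller budget could have declared that budget. -/
theorem truncate_budget (h : Certificate D b B c τ) {i : ι} {x : ℝ≥0} (hx : x ≤ B i)
    (hc : 0 < c i) (hpay : c i * timePrice (τ i) ≤ x) :
    Certificate D b (Function.update B i x) c τ := by
  have hp : timePrice (τ i) ≠ 0 := by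
    intro h0
    rw [h.clicks_eq, demand, h0, div_zero] at hc
    exact hc.ne rfl
  refine ⟨h.feasible, fun j => ?_, h.tight, fun l hl => ?_⟩
  · by_cases hj : j = i
    · subst hj
      rw [h.clicks_eq, demand, div_mul_cancel₀ _ hp] at hpay
      rw [Function.update_self, h.clicks_eq, demand, demand, spend_congr_budget hx hpay]
    · rw [Function.update_of_ne hj]
      exact h.clicks_eq j
  · have hli : l ≠ i := by rintro rfl; exact hp hl
    rw [Function.update_of_ne hli]
    exact h.of_timePrice_eq_zero l hl

/-- A bidder whose price is at most `m` could have declared the bid `m`, unless she loses a tie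
by that. -/
theorem lower_bid (h : Certificate D b B c τ) {i : ι} {m : ℝ≥0} (hm : m < b i)
    (hbid : ∀ l k x, τ l = late m k x → b k = m) (hties : ∀ j, j < i → b j ≠ m)
    (hp : timePrice (τ i) ≤ m) :
    ∃ τ', Certificate D (Function.update b i m) B c τ' := by
  -- With bid `m`, bidder `i` has joined fully not at `early ι m` but at `late m i (B i)`. Only
  -- stops at the former moment have to be postponed.
  set g : Time ι → Time ι := fun t => if t = early ι m then late m i (B i) else t with hg
  -- No other stop is overtaken: stops during the joining at price `m` belong to bidders with bid
  -- `m`, all of whom come after `i`.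
  have hrun : ∀ l k x, τ l = late m k x → i < k := by
    intro l k x hl
    have hk := hbid l k x hl
    rcases lt_trichotomy i k with h1 | h1 | h1
    · exact h1
    · subst h1; exact absurd hk hm.ne'
    · exact absurd hk (hties k h1)
  have hlt : ∀ j l, τ j < τ l → g (τ j) < g (τ l) := by
    intro j l hjl
    simp only [hg]
    split_ifs with h1 h2 h2
    · rw [h1, h2] at hjl; exact absurd hjl (lt_irrefl _)
    · rw [h1] at hjl
      rcases (timePrice_le_of_le hjl.le).lt_or_eq with h3 | h3
      · exact lt_of_timePrice_lt h3
      · rw [timePrice_early] at h3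
        rcases early_or_late (τ l) with h4 | ⟨k, x, h4⟩
        · rw [h3] at h4; exact absurd h4 h2
        · rw [h3] at h4
          have := hrun l k x h4
          rw [h4, ← not_le, late_le_late]
          simp [this.not_gt, this.ne']
    · rw [h2] at hjl
      exact hjl.trans_le (early_le_iff.2 le_rfl)
    · exact hjl
  have hle : ∀ j l, g (τ j) ≤ g (τ l) ↔ τ j ≤ τ l := by
    intro j l
    constructor
    · intro hjl
      by_contra hn
      exact hjl.not_gt (hlt l j (not_le.1 hn))
    · intro hjl
      rcases hjl.lt_or_eq with h1 | h1
      · exact (hlt j l h1).le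
      · rw [h1]
  have hgp : ∀ t, timePrice (g t) = timePrice t := by
    intro t
    simp only [hg]
    split_ifs with h1
    · rw [h1]; rfl
    · rfl
  refine ⟨fun l => g (τ l), h.feasible, fun j => ?_, fun l hl => ?_, fun l hl => ?_⟩
  · rw [h.clicks_eq, demand, demand, hgp]
    congr 1
    by_cases hj : j = i
    · subst hj
      rw [Function.update_self, spend_eq_budget (late_le_of_timePrice_lt (hp.trans_lt hm)),
        spend_eq_budget]
      simp only [hg]
      split_ifs with h1
      · exact le_rfl
      · rcases hp.lt_or_eq with h3 | h3
        · exact late_le_of_timePrice_lt h3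
        · rcases early_or_late (τ j) with h4 | ⟨k, x, h4⟩
          · rw [h3] at h4; exact absurd h4 h1
          · rw [h3] at h4
            rw [h4, late_le_late]
            exact Or.inr ⟨rfl, Or.inl (hrun j k x h4)⟩
    · rw [Function.update_of_ne hj]
      simp only [hg]
      split_ifs with h1
      -- The postponement lets in only bidders with bid `m` before `i`, and there are none.
      · rw [h1, spend, spend]
        congr 1
        ext y
        simp only [Set.mem_ofPred_eq, late_le_early, late_le_late, hj, false_and, or_false]
        have := hties j
        tauto
      · rfl
  · simp only [hgp] at hl
    simp only [hle]
    exact h.tight l hl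
  · simp only [hgp] at hl
    by_cases hli : l = i
    · subst hli
      rcases h.of_timePrice_eq_zero l hl with h1 | h1
      · exact Or.inl h1
      · rw [h1] at hm; exact absurd hm not_lt_zero
    · rw [Function.update_of_ne hli]
      exact h.of_timePrice_eq_zero l hl

end Certificate
end Time

/-! ### From rounds to a certificate -/

section Progress
variable {ι : Type*} [LinearOrder ι]

theorem late_le_late_of_before {b : ι → ℝ≥0} {i j : ι} {x y : ℝ≥0} (h : Before b i j) :
    late (b i) i x ≤ late (b j) j y := by
  rw [late_le_late]
  rcases h with h | ⟨h, h'⟩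
  · exact Or.inl h
  · exact Or.inr ⟨h, Or.inl h'⟩

theorem late_injective_left {p q x y : ℝ≥0} {k l : ι} (h : late p k x = late q l y) :
    p = q ∧ k = l := by
  have h1 : p = q := congrArg timePrice h
  subst h1
  have h3 := late_le_late.1 h.le
  have h4 := late_le_late.1 h.ge
  simp only [lt_self_iff_false, false_or, true_and] at h3 h4
  refine ⟨rfl, ?_⟩
  rcases h3 with h3 | h3
  · rcases h4 with h4 | h4
    · exact absurd h3 h4.not_gt
    · exact h4.1.symm
  · exact h3.1

theorem late_ne_early {p q x : ℝ≥0} {k : ι} : early ι q ≠ late p k x := by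
  intro h
  have h1 : q = p := congrArg timePrice h
  have := h.ge
  rw [late_le_early, h1] at this
  exact lt_irrefl _ this

namespace IsRound
variable {b B B' : ι → ℝ≥0} {D : ℕ → ℝ≥0} {A S K : Finset ι} {u : ℕ} {t : ι} {p : ℝ≥0}

theorem bid_threshold_le (h : IsRound b B D A u S t B' p K) {j : ι} (hj : j ∈ S) : b t ≤ b j := by
  rcases h.before_threshold j hj with rfl | g
  · exact le_rfl
  · exact g.le

/-- The time of a round. -/
theorem exists_time (h : IsRound b B D A u S t B' p K) :
    ∃ t₁ : Time ι, timePrice t₁ = p ∧ (∀ q k x, t₁ = late q k x → b k = q) ∧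
      late (b t) t 0 ≤ t₁ ∧
      (∀ j ∈ A, late (b j) j 0 ≤ t₁ → j ∈ S) ∧
      ∀ i ∈ K, spend (b i) (B i) i t₁ = B' i := by
  -- Below the threshold bid no budget was cut, and everybody considered has joined in full by
  -- `early ι p`. At the threshold bid, the round falls in the moment when `t` has joined with the
  -- uncut part of her budget.
  rcases h.price_le.lt_or_eq with hp | hp
  · have hBt : B' t = B t := h.reduced.resolve_right fun g => hp.ne g.1
    refine ⟨early ι p, rfl, fun q k x he => absurd he late_ne_early, late_le_early.2 hp,
      fun j hj hle => ?_, fun i hi => ?_⟩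
    · by_contra hjS
      exact (late_le_early.1 hle).not_ge (h.le_price j hj hjS)
    · rw [spend_eq_budget (late_le_early.2
        (hp.trans_le (h.bid_threshold_le (h.block_subset hi))))]
      by_cases hit : i = t
      · rw [hit, hBt]
      · rw [h.budget_eq i hit]
  · refine ⟨late p t (B' t), rfl, fun q k x he => ?_, ?_, fun j hj hle => ?_, fun i hi => ?_⟩
    · obtain ⟨h1, h2⟩ := late_injective_left he
      rw [← h2, ← hp, h1]
    · rw [hp]
      exact late_mono zero_le
    · by_contra hjS
      have hb := h.threshold_before j hj hjS
      rw [hp] at hle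
      -- Bidder `t` would pass every amount, even one above `B' t`, before `j` could join.
      have h1 : late (b t) t (B' t + 1) ≤ late (b t) t (B' t) :=
        (late_le_late_of_before hb).trans hle
      have h2 := late_le_late.1 h1
      simp at h2
    · rcases h.before_threshold i (h.block_subset hi) with rfl | hb
      · rw [hp, spend_late_self h.budget_le]
      · have hit : i ≠ t := by rintro rfl; exact Before.irrefl _ _ hb
        rw [h.budget_eq i hit, hp, spend_eq_budget (late_le_late_of_before hb)]

theorem budget_le_budget (h : IsRound b B D A u S t B' p K) (i : ι) : B' i ≤ B i := by
  by_cases hi : i = t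
  · rw [hi]; exact h.budget_le
  · exact (h.budget_eq i hi).le

theorem budget_eq_of_notMem (h : IsRound b B D A u S t B' p K) {i : ι} (hi : i ∉ K) :
    B' i = B i := by
  by_cases hit : i = t
  · subst hit
    exact h.reduced.resolve_right fun g => hi g.2
  · exact h.budget_eq i hit

theorem sum_div_le (h : IsRound b B D A u S t B' p K) {T : Finset ι} (hT : T ⊆ S) :
    ∑ i ∈ T, B' i / p ≤ window D u T.card := by
  rw [← Finset.sum_div]
  exact div_le_of_le_mul₀ zero_le zero_le (by rw [mul_comm]; exact h.sum_le T hT)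

theorem sum_block_div (h : IsRound b B D A u S t B' p K) (hp : 0 < p) :
    ∑ i ∈ K, B' i / p = window D u K.card := by
  rw [← Finset.sum_div, h.sum_block, mul_div_cancel_left₀ _ hp.ne']

theorem budget_or_bid_eq_zero (h : IsRound b B D A u S t B' p K) (hp : p = 0) {i : ι}
    (hi : i ∈ S) : B i = 0 ∨ b i = 0 := by
  have h0 : B' i = 0 := by
    have := h.sum_le {i} (by simpa using hi)
    rwa [hp, zero_mul, Finset.sum_singleton, nonpos_iff_eq_zero] at this
  by_cases hit : i = t
  · subst hit
    rcases h.reduced with g | g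
    · exact Or.inl (g ▸ h0)
    · exact Or.inr (g.1 ▸ hp)
  · exact Or.inl (h.budget_eq i hit ▸ h0)

end IsRound

variable [Fintype ι]

/-- `τ` records the times at which the bidders allocated so far have stopped, and `t₀` is the
time of the last round. -/
structure Progress (D : ℕ → ℝ≥0) (b B : ι → ℝ≥0) (s : State ι) (τ : ι → Time ι) (t₀ : Time ι) :
    Prop where
  used_eq : s.used = (Finset.univ \ s.active).card
  clicks_active : ∀ i ∈ s.active, s.clicks i = 0
  time_le : ∀ i, i ∉ s.active → τ i ≤ t₀
  clicks_eq : ∀ i, i ∉ s.active → s.clicks i = demand (b i) (B i) i (τ i)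
  price_eq : ∀ i, i ∉ s.active → s.price i = timePrice (τ i)
  price_le : ∀ i, s.price i ≤ b i
  charge_le : ∀ i, s.price i * s.clicks i ≤ B i
  of_price_zero : ∀ i, i ∉ s.active → timePrice (τ i) = 0 → B i = 0 ∨ b i = 0
  feasible : ∀ T : Finset ι, ∑ j ∈ T, s.clicks j ≤ window D 0 T.card
  tight : ∀ t, 0 < timePrice t →
    ∑ j ∈ Finset.univ.filter (fun j => j ∉ s.active ∧ τ j ≤ t), s.clicks j =
      window D 0 (Finset.univ.filter (fun j => j ∉ s.active ∧ τ j ≤ t)).card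
  bid_eq : ∀ l, l ∉ s.active → ∀ p k x, τ l = late p k x → b k = p
  last_bid_eq : ∀ p k x, t₀ = late p k x → b k = p
  remaining : ∀ R ⊆ s.active, R.Nonempty → (∀ j ∈ R, late (b j) j 0 ≤ t₀) →
    ∑ j ∈ R, B j < timePrice t₀ * window D s.used R.card


/-- All members of the new block are given the time `t₁` of the round; since `t₁` is later than all
earlier stops, the tight sets of the earlier rounds remain as they were. -/
theorem Progress.step {D : ℕ → ℝ≥0} (hD : Antitone D) {b B B' : ι → ℝ≥0} {s : State ι}
    {τ : ι → Time ι} {t₀ : Time ι} {S K : Finset ι} {t : ι} {p : ℝ≥0}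
    (h : Progress D b B s τ t₀) (hr : IsRound b B D s.active s.used S t B' p K) :
    ∃ τ' t₁, Progress D b B (s.allocate K B' p) τ' t₁ := by
  obtain ⟨t₁, hp₁, hbid₁, hjoin, hmem, hspend⟩ := hr.exists_time
  have hKA : K ⊆ s.active := hr.block_subset.trans hr.subset
  -- If everyone considered had joined by `t₀`, the strict inequality left by the last round forces
  -- a lower price. Otherwise someone joins after `t₀`, and the threshold bidder, who joins last,
  -- has joined by `t₁`.
  have hlt : t₀ < t₁ := by
    by_cases hall : ∀ j ∈ S, late (b j) j 0 ≤ t₀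
    · apply lt_of_timePrice_lt
      have h1 := h.remaining K hKA hr.block_nonempty fun j hj => hall j (hr.block_subset hj)
      have h2 : ∑ j ∈ K, B' j ≤ ∑ j ∈ K, B j :=
        Finset.sum_le_sum fun j _ => hr.budget_le_budget j
      rw [hr.sum_block] at h2
      rw [hp₁]
      exact lt_of_mul_lt_mul_right (h2.trans_lt h1) zero_le
    · push Not at hall
      obtain ⟨j, hj, hjt⟩ := hall
      refine hjt.trans_le (le_trans ?_ hjoin)
      rcases hr.before_threshold j hj with rfl | hb
      · exact le_rfl
      · exact late_le_late_of_before hb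
  have hinact : ∀ j, j ∉ s.active \ K ↔ j ∉ s.active ∨ j ∈ K := by
    intro j; rw [Finset.mem_sdiff]; tauto
  have hnotK : ∀ j, j ∉ s.active → j ∉ K := fun j hj hjK => hj (hKA hjK)
  have huniv : Finset.univ \ (s.active \ K) = (Finset.univ \ s.active) ∪ K := by
    ext j
    simp only [Finset.mem_sdiff, Finset.mem_univ, true_and, Finset.mem_union]
    tauto
  have hdisj : Disjoint (Finset.univ \ s.active) K := by
    rw [Finset.disjoint_left]
    intro j hj
    exact hnotK j (Finset.mem_sdiff.1 hj).2
  set s' := s.allocate K B' p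
  have hact : s'.active = s.active \ K := rfl
  have hused : s'.used = s.used + K.card := rfl
  have hcK : ∀ j ∈ K, s'.clicks j = B' j / p := fun j hj => if_pos hj
  have hcn : ∀ j, j ∉ K → s'.clicks j = s.clicks j := fun j hj => if_neg hj
  have hpK : ∀ j ∈ K, s'.price j = p := fun j hj => if_pos hj
  have hpn : ∀ j, j ∉ K → s'.price j = s.price j := fun j hj => if_neg hj
  refine ⟨fun i => if i ∈ K then t₁ else τ i, t₁, ?_⟩
  constructor
  · rw [hused, hact, huniv, Finset.card_union_of_disjoint hdisj, h.used_eq]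
  · intro i hi
    rw [hact, Finset.mem_sdiff] at hi
    rw [hcn i hi.2]
    exact h.clicks_active i hi.1
  · intro i hi
    rw [hact, hinact] at hi
    split_ifs with hiK
    · exact le_rfl
    · exact (h.time_le i (hi.resolve_right hiK)).trans hlt.le
  · intro i hi
    rw [hact, hinact] at hi
    split_ifs with hiK
    · rw [hcK i hiK, demand, hp₁, hspend i hiK]
    · rw [hcn i hiK]
      exact h.clicks_eq i (hi.resolve_right hiK)
  · intro i hi
    rw [hact, hinact] at hi
    split_ifs with hiK
    · rw [hpK i hiK, hp₁]
    · rw [hpn i hiK]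
      exact h.price_eq i (hi.resolve_right hiK)
  · intro i
    by_cases hiK : i ∈ K
    · rw [hpK i hiK]
      exact hr.price_le.trans (hr.bid_threshold_le (hr.block_subset hiK))
    · rw [hpn i hiK]
      exact h.price_le i
  · intro i
    by_cases hiK : i ∈ K
    · rw [hpK i hiK, hcK i hiK]
      refine le_trans ?_ (hr.budget_le_budget i)
      rcases eq_or_ne p 0 with hp | hp
      · simp [hp]
      · rw [mul_div_cancel₀ _ hp]
    · rw [hpn i hiK, hcn i hiK]
      exact h.charge_le i
  · intro i hi h0
    rw [hact, hinact] at hi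
    split_ifs at h0 with hiK
    · exact hr.budget_or_bid_eq_zero (hp₁ ▸ h0) (hr.block_subset hiK)
    · exact h.of_price_zero i (hi.resolve_right hiK) h0
  · intro T
    -- The part of `T` allocated earlier fits into the first slots. It has at most `s.used` members,
    -- so the part in `K` can be charged to the slots directly after them, which are at least as
    -- good as its own.
    rw [← Finset.sum_inter_add_sum_sdiff T K]
    have h1 : ∑ j ∈ T ∩ K, s'.clicks j ≤ window D s.used (T ∩ K).card := by
      rw [Finset.sum_congr rfl fun j hj => hcK j (Finset.mem_inter.1 hj).2]
      exact hr.sum_div_le (Finset.inter_subset_right.trans hr.block_subset)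
    have h2 : ∑ j ∈ T \ K, s'.clicks j ≤ window D 0 (T \ s.active).card := by
      rw [Finset.sum_congr rfl fun j hj => hcn j (Finset.mem_sdiff.1 hj).2]
      refine le_trans (le_of_eq ?_) (h.feasible (T \ s.active))
      symm
      apply Finset.sum_subset (Finset.sdiff_subset_sdiff le_rfl hKA)
      intro j hj hj'
      apply h.clicks_active
      by_contra hn
      exact hj' (Finset.mem_sdiff.2 ⟨(Finset.mem_sdiff.1 hj).1, hn⟩)
    have h3 : (T \ s.active).card ≤ s.used := by
      rw [h.used_eq]
      exact Finset.card_le_card (Finset.sdiff_subset_sdiff (Finset.subset_univ _) le_rfl)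
    have h4 : (T \ s.active).card + (T ∩ K).card ≤ T.card := by
      have h5 := Finset.card_sdiff_add_card_inter T K
      have h6 := Finset.card_le_card (Finset.sdiff_subset_sdiff (le_refl T) hKA)
      omega
    calc _ ≤ window D (T \ s.active).card (T ∩ K).card + window D 0 (T \ s.active).card :=
          add_le_add (h1.trans (window_anti hD h3 _)) h2
      _ = window D 0 ((T \ s.active).card + (T ∩ K).card) := by
          rw [window_add, zero_add, add_comm]
      _ ≤ _ := window_mono D 0 h4
  · intro x hx
    by_cases hle : t₁ ≤ x
    · have hp0 : 0 < timePrice t₁ := hx.trans_le (timePrice_le_of_le hle)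
      have hf : Finset.univ.filter (fun j => j ∉ s'.active ∧
          (if j ∈ K then t₁ else τ j) ≤ x) = (Finset.univ \ s.active) ∪ K := by
        rw [← huniv, ← hact]
        ext j
        simp only [Finset.mem_filter, Finset.mem_univ, true_and, Finset.mem_sdiff,
          and_iff_left_iff_imp]
        intro hj
        split_ifs with hjK
        · exact hle
        · rw [hact, hinact] at hj
          exact (h.time_le j (hj.resolve_right hjK)).trans (hlt.le.trans hle)
      have hold := h.tight t₀ (hp0.trans_le (timePrice_le_of_le hlt.le))
      have hf' : Finset.univ.filter (fun j => j ∉ s.active ∧ τ j ≤ t₀) =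
          Finset.univ \ s.active := by
        ext j
        simp only [Finset.mem_filter, Finset.mem_univ, true_and, Finset.mem_sdiff,
          and_iff_left_iff_imp]
        exact h.time_le j
      rw [hf', ← h.used_eq] at hold
      rw [hf, Finset.sum_union hdisj, Finset.card_union_of_disjoint hdisj, ← h.used_eq,
        window_add, zero_add, Finset.sum_congr rfl hcK, hr.sum_block_div (hp₁ ▸ hp0), ← hold]
      congr 1
      exact Finset.sum_congr rfl fun j hj => hcn j (hnotK j (Finset.mem_sdiff.1 hj).2)
    · have hf : Finset.univ.filter (fun j => j ∉ s'.active ∧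
          (if j ∈ K then t₁ else τ j) ≤ x) =
          Finset.univ.filter (fun j => j ∉ s.active ∧ τ j ≤ x) := by
        ext j
        simp only [Finset.mem_filter, Finset.mem_univ, true_and, hact, hinact]
        by_cases hjK : j ∈ K
        · simp [hjK, hle, hKA hjK]
        · simp [hjK]
      rw [hf, ← h.tight x hx]
      exact Finset.sum_congr rfl fun j hj => hcn j (hnotK j (Finset.mem_filter.1 hj).2.1)
  · intro l hl q k x hτ
    rw [hact, hinact] at hl
    split_ifs at hτ with hlK
    · exact hbid₁ q k x hτ
    · exact h.bid_eq l (hl.resolve_right hlK) q k x hτ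
  · exact hbid₁
  · intro R hR hne hjo
    rw [hact] at hR
    -- Whoever had joined by `t₁` was considered in this round. Outside `K` no budget was cut.
    have hRS : R ⊆ S \ K := fun j hj => by
      have := Finset.mem_sdiff.1 (hR hj)
      exact Finset.mem_sdiff.2 ⟨hmem j this.1 (hjo j hj), this.2⟩
    rw [hused, hp₁, ← Finset.sum_congr rfl fun j hj =>
      hr.budget_eq_of_notMem (Finset.mem_sdiff.1 (hRS hj)).2]
    exact hr.sum_lt R hRS hne

theorem Progress.certificate {D : ℕ → ℝ≥0} {b B : ι → ℝ≥0} {s : State ι}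
    {τ : ι → Time ι} {t₀ : Time ι} (h : Progress D b B s τ t₀)
    (hdone : s.active = ∅ ∨ ∀ j, D (s.used + j) = 0) :
    ∃ τ', Certificate D b B s.clicks τ' ∧ (∀ l p k x, τ' l = late p k x → b k = p) ∧
      ∀ i, s.clicks i ≠ 0 → s.price i = timePrice (τ' i) := by
  have hout : ∀ i ∈ s.active, ¬ late (b i) i 0 ≤ t₀ := by
    intro i hi hle
    have h1 := h.remaining {i} (by simpa using hi) (by simp) (by simpa using hle)
    rcases hdone with h2 | h2
    · rw [h2] at hi; simp at hi
    · simp [window, h2] at h1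
  have hwin : window D s.used s.active.card = 0 := by
    rcases hdone with h2 | h2
    · simp [h2, window]
    · simp [window, h2]
  -- Bidders left over have not joined by `t₀`, so stopping them there gives demand zero; tightness
  -- survives because the remaining slots have no clicks or nobody remains.
  refine ⟨fun i => if i ∈ s.active then t₀ else τ i, ⟨h.feasible, fun j => ?_, fun l hl => ?_,
    fun l hl => ?_⟩, fun l p k x hl => ?_, fun i hi => ?_⟩
  · split_ifs with hj
    · rw [h.clicks_active j hj, demand, spend_eq_zero (hout j hj), zero_div]
    · exact h.clicks_eq j hj
  · set x := if l ∈ s.active then t₀ else τ l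
    by_cases hle : t₀ ≤ x
    · have hf : Finset.univ.filter (fun j => (if j ∈ s.active then t₀ else τ j) ≤ x) =
          Finset.univ := by
        apply Finset.filter_true_of_mem
        intro j _
        split_ifs with hj
        · exact hle
        · exact (h.time_le j hj).trans hle
      have hf' : Finset.univ.filter (fun j => j ∉ s.active ∧ τ j ≤ t₀) =
          Finset.univ \ s.active := by
        ext j
        simp only [Finset.mem_filter, Finset.mem_univ, true_and, Finset.mem_sdiff,
          and_iff_left_iff_imp]
        exact h.time_le j
      have hold := h.tight t₀ (hl.trans_le (timePrice_le_of_le hle))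
      rw [hf', ← h.used_eq] at hold
      have hcard : (Finset.univ : Finset ι).card = s.used + s.active.card := by
        rw [h.used_eq, Finset.card_sdiff_add_card_eq_card (Finset.subset_univ _)]
      rw [hf, hcard, window_add, zero_add, hwin, add_zero, ← hold]
      symm
      apply Finset.sum_subset (Finset.subset_univ _)
      intro j _ hj
      apply h.clicks_active
      simpa using hj
    · have hf : Finset.univ.filter (fun j => (if j ∈ s.active then t₀ else τ j) ≤ x) =
          Finset.univ.filter (fun j => j ∉ s.active ∧ τ j ≤ x) := by
        ext j
        by_cases hj : j ∈ s.active
        · simp [hj, hle]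
        · simp [hj]
      rw [hf]
      exact h.tight x hl
  · split_ifs at hl with hi
    · right
      by_contra hb
      exact hout l hi (late_le_of_timePrice_lt (hl ▸ pos_iff_ne_zero.2 hb))
    · exact h.of_price_zero l hi hl
  · beta_reduce at hl
    split_ifs at hl with hi
    · exact h.last_bid_eq p k x hl
    · exact h.bid_eq l hi p k x hl
  · have hiA : i ∉ s.active := fun hA => hi (h.clicks_active i hA)
    beta_reduce
    rw [if_neg hiA]
    exact h.price_eq i hiA

end Progress

/-! ### Induction over the rounds -/

section Run
variable {ι : Type*} [LinearOrder ι]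

theorem exists_isRound_round {b B : ι → ℝ≥0} {D : ℕ → ℝ≥0} (hD : Antitone D) {s : State ι}
    (h : ¬ (s.active = ∅ ∨ ∀ j, D (s.used + j) = 0)) :
    ∃ S t B' p K, IsRound b B D s.active s.used S t B' p K ∧
      round b B D s = s.allocate K B' p := by
  push Not at h
  have h0 : 0 < D s.used := by
    obtain ⟨j, hj⟩ := h.2
    exact (pos_iff_ne_zero.2 hj).trans_le (hD (by omega))
  exact exists_isRound b B hD h.1 h0

variable [Fintype ι]

/-- The state before the first round. -/
def initialState (ι : Type*) [Fintype ι] : State ι where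
  active := Finset.univ
  used := 0
  clicks := fun _ => 0
  price := fun _ => 0
  slots := fun _ => Set.univ

/-- Each round that is not idle removes a nonempty block, so `Fintype.card ι` iterations reach the
stopping condition. Later proofs need only `IsRound`, not the definition of `round`. -/
theorem priceSetting_induction {b B : ι → ℝ≥0} {D : ℕ → ℝ≥0} (hD : Antitone D)
    (P : State ι → Prop) (h0 : P (initialState ι))
    (hstep : ∀ s S t B' p K, P s → IsRound b B D s.active s.used S t B' p K →
      P (s.allocate K B' p)) :
    P (priceSetting b B D) ∧ ((priceSetting b B D).active = ∅ ∨
      ∀ j, D ((priceSetting b B D).used + j) = 0) := by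
  have key : ∀ n, P ((round b B D)^[n] (initialState ι)) ∧
      ((((round b B D)^[n] (initialState ι)).active = ∅ ∨
        ∀ j, D (((round b B D)^[n] (initialState ι)).used + j) = 0) ∨
      ((round b B D)^[n] (initialState ι)).active.card + n ≤ Fintype.card ι) := by
    intro n
    induction n with
    | zero => exact ⟨h0, Or.inr (Finset.card_le_univ _)⟩
    | succ n ih =>
      rw [Function.iterate_succ_apply']
      set s := (round b B D)^[n] (initialState ι)
      by_cases hdone : s.active = ∅ ∨ ∀ j, D (s.used + j) = 0
      · rw [round_of_done hdone]
        exact ⟨ih.1, Or.inl hdone⟩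
      · obtain ⟨S, t, B', p, K, hr, he⟩ := exists_isRound_round (b := b) (B := B) hD hdone
        rw [he]
        refine ⟨hstep s S t B' p K ih.1 hr, Or.inr ?_⟩
        have h1 := ih.2.resolve_left hdone
        have h2 : (s.allocate K B' p).active.card < s.active.card := by
          apply Finset.card_lt_card
          exact Finset.sdiff_ssubset (hr.block_subset.trans hr.subset) hr.block_nonempty
        omega
  obtain ⟨h1, h2⟩ := key (Fintype.card ι)
  refine ⟨h1, h2.elim id fun h3 => Or.inl ?_⟩
  rw [← Finset.card_eq_zero]
  change ((round b B D)^[Fintype.card ι] (initialState ι)).active.card = 0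
  omega

theorem progress_initialState (D : ℕ → ℝ≥0) (b B : ι → ℝ≥0) :
    ∃ τ t₀, Progress D b B (initialState ι) τ t₀ := by
  have hlt : ∀ j, b j < ∑ i, b i + 1 := fun j =>
    (Finset.single_le_sum (f := b) (fun _ _ => zero_le) (Finset.mem_univ j)).trans_lt
      (lt_add_one _)
  -- This starting price exceeds every bid, so nobody has joined; the stop times are dummies, since
  -- nobody has been allocated.
  refine ⟨fun _ => early ι 0, early ι (∑ i, b i + 1), ?_⟩
  constructor
  case remaining =>
    intro R _ ⟨j, hj⟩ h
    exact absurd (late_le_early.1 (h j hj)) (hlt j).not_gt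
  case last_bid_eq =>
    intro p k x h
    exact absurd h late_ne_early
  all_goals simp [initialState, window]

theorem priceSetting_certificate {D : ℕ → ℝ≥0} (hD : Antitone D) (b B : ι → ℝ≥0) :
    (∀ i, (priceSetting b B D).price i ≤ b i) ∧
    (∀ i, (priceSetting b B D).price i * (priceSetting b B D).clicks i ≤ B i) ∧
    ∃ τ, Certificate D b B (priceSetting b B D).clicks τ ∧
      (∀ l p k x, τ l = late p k x → b k = p) ∧
      ∀ i, (priceSetting b B D).clicks i ≠ 0 →
        (priceSetting b B D).price i = timePrice (τ i) := by
  obtain ⟨⟨τ, t₀, h⟩, hdone⟩ := priceSetting_induction (b := b) (B := B) hD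
    (fun s => ∃ τ t₀, Progress D b B s τ t₀) (progress_initialState D b B)
    (fun s S t B' p K hs hr => by
      obtain ⟨τ, t₀, h⟩ := hs
      exact h.step hD hr)
  exact ⟨h.price_le, h.charge_le, h.certificate hdone⟩

end Run

/-! ### Majorization and mixtures of permutations -/

section Majorization

/-- Summation by parts. It is applied to differences with total zero, where the left side vanishes.
-/
theorem mul_sum_le_sum_mul (v z : ℕ → ℝ) (n : ℕ) (hv : ∀ j < n, v (j + 1) ≤ v j)
    (hz : ∀ l ≤ n, 0 ≤ ∑ j ∈ Finset.range l, z j) :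
    v n * ∑ j ∈ Finset.range (n + 1), z j ≤ ∑ j ∈ Finset.range (n + 1), v j * z j := by
  induction n with
  | zero => simp
  | succ n ih =>
    have h1 := ih (fun j hj => hv j (by omega)) (fun l hl => hz l (by omega))
    rw [Finset.sum_range_succ, Finset.sum_range_succ _ (n + 1)]
    have h2 := mul_le_mul_of_nonneg_right (hv n (by omega)) (hz (n + 1) le_rfl)
    linarith

theorem sum_mul_le_sum_mul_of_prefix {n : ℕ} (v y d : Fin n → ℝ) (hv : Antitone v)
    (hle : ∀ l (hl : l ≤ n), ∑ j : Fin l, y (Fin.castLE hl j) ≤ ∑ j : Fin l, d (Fin.castLE hl j))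
    (heq : ∑ j, y j = ∑ j, d j) : ∑ j, v j * y j ≤ ∑ j, v j * d j := by
  cases n with
  | zero => simp
  | succ n =>
    have key := mul_sum_le_sum_mul (fun j => if h : j < n + 1 then v ⟨j, h⟩ else 0)
      (fun j => if h : j < n + 1 then d ⟨j, h⟩ - y ⟨j, h⟩ else 0) n
      (fun j hj => by
        have h1 : j < n + 1 := by omega
        have h2 : j + 1 < n + 1 := by omega
        simp only [h1, h2, dif_pos]
        exact hv (by simp))
      (fun l hl => by
        have hl' : l ≤ n + 1 := by omega
        rw [Finset.sum_range]
        have : ∀ j : Fin l, (if h : (j : ℕ) < n + 1 then d ⟨j, h⟩ - y ⟨j, h⟩ else 0) =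
            d (Fin.castLE hl' j) - y (Fin.castLE hl' j) := by
          intro j
          rw [dif_pos (by omega : (j : ℕ) < n + 1)]
          rfl
        rw [Finset.sum_congr rfl fun j _ => this j, Finset.sum_sub_distrib, sub_nonneg]
        exact hle l hl')
    rw [Finset.sum_range, Finset.sum_range] at key
    simp only [Fin.is_lt, dif_pos, Fin.eta, Finset.sum_sub_distrib, mul_sub] at key
    rw [heq, sub_self] at key
    linarith

/-- Rado's theorem. -/
theorem mem_convexHull_perm {n : ℕ} (x d : Fin n → ℝ)
    (hle : ∀ l (hl : l ≤ n) (T : Finset (Fin n)), T.card = l →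
      ∑ j ∈ T, x j ≤ ∑ j : Fin l, d (Fin.castLE hl j))
    (heq : ∑ j, x j = ∑ j, d j) :
    x ∈ convexHull ℝ (Set.range fun σ : Equiv.Perm (Fin n) => d ∘ σ) := by
  by_contra hx
  obtain ⟨f, a, hf, hfx⟩ := geometric_hahn_banach_closed_point (convex_convexHull ℝ _)
    ((Set.finite_range fun σ : Equiv.Perm (Fin n) => d ∘ σ).isClosed_convexHull ℝ) hx
  set w : Fin n → ℝ := fun i => f (Pi.single i 1) with hw
  have hfw : ∀ y, f y = ∑ i, w i * y i := by
    intro y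
    have := LinearMap.pi_apply_eq_sum_univ (f : (Fin n → ℝ) →ₗ[ℝ] ℝ) y
    simp only [ContinuousLinearMap.coe_coe, smul_eq_mul] at this
    rw [this]
    refine Finset.sum_congr rfl fun i _ => ?_
    rw [mul_comm, hw]
    congr 2
    ext j
    simp [Pi.single_apply, eq_comm]
  -- With the weights of the separating functional in decreasing order, the prefix inequalities show
  -- that a permutation of `d` scores at least as high as `x`.
  set π := Tuple.sort (fun i => -w i)
  have hanti : Antitone (w ∘ π) := by
    intro i j hij
    have := Tuple.monotone_sort (fun i => -w i) hij
    simpa using this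
  have hmain := sum_mul_le_sum_mul_of_prefix (w ∘ π) (x ∘ π) d hanti
    (fun l hl => by
      have := hle l hl (Finset.univ.map ((Fin.castLEEmb hl).trans π.toEmbedding)) (by simp)
      simpa using this)
    (by rw [← heq]; exact Equiv.sum_comp π x)
  have h1 : f x = ∑ j, (w ∘ π) j * (x ∘ π) j := by
    rw [hfw]
    exact (Equiv.sum_comp π fun i => w i * x i).symm
  have h2 : f (d ∘ π.symm) = ∑ j, (w ∘ π) j * d j := by
    rw [hfw, ← Equiv.sum_comp π]
    simp
  have h3 := hf (d ∘ π.symm) (subset_convexHull ℝ _ ⟨π.symm, rfl⟩)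
  rw [← h1, ← h2] at hmain
  linarith

end Majorization

/-! ### Timetables for the blocks -/

section Scheduling
variable {ι : Type*}

/-- A mixture of matchings between bidders and slots is realized by a schedule that runs the
matchings one after the other. -/
theorem exists_schedule_of_mixture [DecidableEq ι] {m N : ℕ} (D : Fin m → ℝ≥0) (K : Finset ι)
    (w : Fin N → ℝ) (hw : ∀ k, 0 ≤ w k) (hw1 : ∑ k, w k = 1) (slot : Fin N → ι → ℕ)
    (hinj : ∀ k, Set.InjOn (slot k) K) :
    ∃ σ : Schedule ι m, σ.Feasible ∧ (∀ i, i ∉ K → σ i = ∅) ∧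
      (∀ i ∈ K, σ.clicks D i = ∑ k, w k * (pad D (slot k i) : ℝ)) ∧
      ∀ i, ∀ a ∈ σ i, ∃ k, (a.slot : ℕ) = slot k i := by
  classical
  -- Matching `k` runs from `W k` to `W k + w k`.
  set W : Fin N → ℝ := fun k => ∑ j ∈ Finset.univ.filter (fun j => j < k), w j with hW
  have hstep : ∀ k k', k < k' → W k + w k ≤ W k' := by
    intro k k' hk
    rw [hW, add_comm]
    rw [← Finset.sum_insert (by simp)]
    refine Finset.sum_le_sum_of_subset_of_nonneg (fun j hj => ?_) fun j _ _ => hw j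
    simp only [Finset.mem_insert, Finset.mem_filter, Finset.mem_univ, true_and] at hj ⊢
    rcases hj with rfl | hj
    · exact hk
    · exact hj.trans hk
  have hend : ∀ k, W k + w k ≤ 1 := by
    intro k
    rw [hW, add_comm, ← hw1]
    rw [← Finset.sum_insert (by simp)]
    exact Finset.sum_le_sum_of_subset_of_nonneg (Finset.subset_univ _) fun j _ _ => hw j
  have hdisj : ∀ k k', k ≠ k' →
      Disjoint (Set.Ico (W k) (W k + w k)) (Set.Ico (W k') (W k' + w k')) := by
    intro k k' hk
    rw [Set.Ico_disjoint_Ico]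
    rcases lt_or_gt_of_ne hk with h | h
    · exact (min_le_left _ _).trans ((hstep k k' h).trans (le_max_right _ _))
    · exact (min_le_right _ _).trans ((hstep k' k h).trans (le_max_left _ _))
  -- Empty intervals and dummy slots are dropped; neither carries any clicks.
  set good : ι → Finset (Fin N) := fun i =>
    Finset.univ.filter (fun k => i ∈ K ∧ 0 < w k ∧ slot k i < m) with hgood
  have hlt : ∀ i (k : {k // k ∈ good i}), slot k i < m := fun i k =>
    (Finset.mem_filter.1 k.2).2.2.2
  have hpos : ∀ i (k : {k // k ∈ good i}), 0 < w k := fun i k =>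
    (Finset.mem_filter.1 k.2).2.2.1
  have hmemK : ∀ i (k : {k // k ∈ good i}), i ∈ K := fun i k =>
    (Finset.mem_filter.1 k.2).2.1
  set pl : ∀ i, {k // k ∈ good i} → Placement m := fun i k =>
    ⟨⟨slot k i, hlt i k⟩, W k, W k + w k⟩ with hpl
  have hplinj : ∀ i, Function.Injective (pl i) := by
    intro i k k' h
    by_contra hne
    have hne' : (k : Fin N) ≠ k' := fun h' => hne (Subtype.ext h')
    have h1 : W k = W k' := congrArg Placement.start h
    have h2 : W k + w k = W k' + w k' := congrArg Placement.finish h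
    have h3 := hdisj k k' hne'
    rw [h1, ← h2, h1, disjoint_self, Set.bot_eq_empty, Set.Ico_eq_empty_iff] at h3
    exact h3 (by have := hpos i k; linarith)
  refine ⟨fun i => (good i).attach.image (pl i), ⟨?_, ?_, ?_⟩, ?_, ?_, ?_⟩
  · intro i a ha
    obtain ⟨k, _, rfl⟩ := Finset.mem_image.1 ha
    have h0 : 0 ≤ W k := Finset.sum_nonneg fun j _ => hw j
    refine ⟨h0, ?_, hend k⟩
    have := hpos i k
    simp only [hpl]
    linarith
  · intro i i' a ha a' ha' hne hs
    obtain ⟨k, _, rfl⟩ := Finset.mem_image.1 ha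
    obtain ⟨k', _, rfl⟩ := Finset.mem_image.1 ha'
    by_cases hk : (k : Fin N) = k'
    · exfalso
      apply hne
      have hs' : slot k i = slot k' i' := congrArg Fin.val hs
      rw [← hk] at hs'
      have hi := hinj k (hmemK i k) (hmemK i' k') hs'
      subst hi
      rw [Subtype.ext hk]
    · exact hdisj k k' hk
  · intro i a ha a' ha' hne
    obtain ⟨k, _, rfl⟩ := Finset.mem_image.1 ha
    obtain ⟨k', _, rfl⟩ := Finset.mem_image.1 ha'
    refine hdisj k k' fun hk => hne ?_
    rw [Subtype.ext hk]
  · intro i hi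
    simp [hgood, hi]
  · intro i hi
    change ∑ a ∈ (good i).attach.image (pl i), (a.finish - a.start) * (D a.slot : ℝ) = _
    rw [Finset.sum_image (fun _ _ _ _ h => hplinj i h)]
    have h1 : ∀ k : {k // k ∈ good i}, ((pl i k).finish - (pl i k).start) *
        (D (pl i k).slot : ℝ) = w k * (pad D (slot k i) : ℝ) := by
      intro k
      simp only [hpl, pad, dif_pos (hlt i k)]
      ring
    rw [Finset.sum_congr rfl fun k _ => h1 k,
      Finset.sum_attach (good i) fun k => w k * (pad D (slot k i) : ℝ)]
    apply Finset.sum_subset (Finset.subset_univ _)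
    intro k _ hk
    simp only [hgood, Finset.mem_filter, Finset.mem_univ, true_and, hi, not_and, not_lt] at hk
    by_cases h0 : 0 < w k
    · rw [pad, dif_neg (hk h0).not_gt]
      simp
    · rw [le_antisymm (not_lt.1 h0) (hw k), zero_mul]
  · intro i a ha
    obtain ⟨k, _, rfl⟩ := Finset.mem_image.1 ha
    exact ⟨k, rfl⟩

/-- The bidders of a block can be scheduled in the slots of the block. -/
theorem exists_block_schedule [DecidableEq ι] {m : ℕ} (D : Fin m → ℝ≥0) (u : ℕ) (K : Finset ι)
    (c : ι → ℝ≥0) (hle : ∀ T ⊆ K, ∑ i ∈ T, c i ≤ window (pad D) u T.card)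
    (heq : ∑ i ∈ K, c i = window (pad D) u K.card) :
    ∃ σ : Schedule ι m, σ.Feasible ∧ (∀ i, i ∉ K → σ i = ∅) ∧
      (∀ i ∈ K, σ.clicks D i = c i) ∧
      ∀ i, ∀ a ∈ σ i, (a.slot : ℕ) ∈ Set.Ico u (u + K.card) := by
  set e := K.equivFin
  have hwin : ∀ l (hl : l ≤ K.card),
      ∑ j : Fin l, (pad D (u + (Fin.castLE hl j : Fin K.card)) : ℝ) = window (pad D) u l := by
    intro l hl
    rw [window, NNReal.coe_sum, Finset.sum_range]
    rfl
  have hhull := mem_convexHull_perm (n := K.card) (fun j => (c (e.symm j) : ℝ))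
    (fun j => (pad D (u + j) : ℝ))
    (fun l hl T hT => by
      have h1 := hle (T.map (e.symm.toEmbedding.trans (Function.Embedding.subtype _)))
        (fun i hi => by
          obtain ⟨j, _, rfl⟩ := Finset.mem_map.1 hi
          exact (e.symm j).2)
      rw [Finset.sum_map, Finset.card_map, hT, ← NNReal.coe_le_coe, NNReal.coe_sum] at h1
      rw [hwin l hl]
      exact h1)
    (by
      have h1 := hwin K.card le_rfl
      simp only [Fin.castLE_rfl, id] at h1
      rw [h1, ← heq, NNReal.coe_sum, ← Finset.sum_coe_sort K]
      exact Equiv.sum_comp e.symm fun i : K => (c i : ℝ))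
  obtain ⟨κ, _, w, z, hw, hw1, hz, hx⟩ := mem_convexHull_iff_exists_fintype.1 hhull
  choose π hπ using hz
  set g := Fintype.equivFin κ
  obtain ⟨σ, h1, h2, h3, h4⟩ := exists_schedule_of_mixture D K (fun k => w (g.symm k))
    (fun k => hw _) (by rw [← hw1]; exact Equiv.sum_comp g.symm w)
    (fun k i => if h : i ∈ K then u + (π (g.symm k) (e ⟨i, h⟩) : ℕ) else 0)
    (fun k i hi i' hi' h => by
      have hi : i ∈ K := hi
      have hi' : i' ∈ K := hi'
      simp only [hi, hi', dif_pos, add_right_inj] at h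
      have := e.injective ((π (g.symm k)).injective (Fin.ext h))
      exact congrArg Subtype.val this)
  refine ⟨σ, h1, h2, fun i hi => ?_, fun i a ha => ?_⟩
  · rw [h3 i hi]
    have hxi := congrFun hx (e ⟨i, hi⟩)
    simp only [Equiv.symm_apply_apply] at hxi
    rw [← hxi, ← Equiv.sum_comp g.symm, Finset.sum_apply]
    refine Finset.sum_congr rfl fun k _ => ?_
    rw [dif_pos hi, Pi.smul_apply, ← hπ]
    rfl
  · obtain ⟨k, hk⟩ := h4 i a ha
    have hi : i ∈ K := by
      by_contra hn
      rw [h2 i hn] at ha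
      simp at ha
    rw [dif_pos hi] at hk
    rw [hk]
    exact ⟨by omega, by omega⟩

/-- Schedules of different bidders in different slots can be combined. -/
theorem Schedule.Feasible.piecewise [DecidableEq ι] {m : ℕ} {σ ρ : Schedule ι m} {K : Finset ι}
    {u : ℕ} (hσ : σ.Feasible) (hρ : ρ.Feasible)
    (hσu : ∀ i ∈ K, ∀ a ∈ σ i, u ≤ (a.slot : ℕ))
    (hρu : ∀ i, ∀ a ∈ ρ i, (a.slot : ℕ) < u) :
    Schedule.Feasible (fun i => if i ∈ K then σ i else ρ i : Schedule ι m) := by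
  refine ⟨fun i a ha => ?_, fun i i' a ha a' ha' hne hs => ?_, fun i a ha a' ha' hne => ?_⟩
  · beta_reduce at ha
    split_ifs at ha
    · exact hσ.interval i a ha
    · exact hρ.interval i a ha
  · beta_reduce at ha ha'
    split_ifs at ha ha' with h1 h2 h2
    · exact hσ.slot_disjoint i i' a ha a' ha' hne hs
    · have h3 := hσu i h1 a ha
      have h4 := hρu i' a' ha'
      rw [hs] at h3
      omega
    · have h3 := hσu i' h2 a' ha'
      have h4 := hρu i a ha
      rw [hs] at h4
      omega
    · exact hρ.slot_disjoint i i' a ha a' ha' hne hs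
  · beta_reduce at ha ha'
    split_ifs at ha ha'
    · exact hσ.bidder_disjoint i a ha a' ha' hne
    · exact hρ.bidder_disjoint i a ha a' ha' hne

variable [LinearOrder ι] [Fintype ι]

theorem pad_antitone {m : ℕ} {D : Fin m → ℝ≥0} (hD : StrictAnti D) : Antitone (pad D) := by
  intro i j hij
  unfold pad
  split_ifs with h1 h2
  · exact hD.antitone hij
  · omega
  · exact zero_le
  · exact le_rfl

/-- The computed clicks are realized by a feasible schedule in the slots of the blocks. -/
theorem exists_schedule_priceSetting {m : ℕ} {D : Fin m → ℝ≥0} (hD : StrictAnti D)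
    (b B : ι → ℝ≥0) :
    ∃ σ : Schedule ι m, σ.Feasible ∧
      (∀ i, σ.clicks D i = (priceSetting b B (pad D)).clicks i) ∧
      ∀ i, ∀ a ∈ σ i, (a.slot : ℕ) ∈ (priceSetting b B (pad D)).slots i := by
  have key := (priceSetting_induction (b := b) (B := B) (pad_antitone hD)
    (fun s => ∃ σ : Schedule ι m, σ.Feasible ∧ (∀ i, σ.clicks D i = s.clicks i) ∧
      ∀ i, ∀ a ∈ σ i, (a.slot : ℕ) ∈ s.slots i ∧ (a.slot : ℕ) < s.used)
    ⟨fun _ => ∅, ⟨by simp, by simp, by simp⟩, by simp [Schedule.clicks, initialState], by simp⟩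
    (fun s S t B' p K hs hr => by
      obtain ⟨ρ, hρ, hρc, hρs⟩ := hs
      obtain ⟨σ, hσ, hσc, hσs⟩ : ∃ σ : Schedule ι m, σ.Feasible ∧
          (∀ i ∈ K, σ.clicks D i = ((B' i / p : ℝ≥0) : ℝ)) ∧
          ∀ i, ∀ a ∈ σ i, (a.slot : ℕ) ∈ Set.Ico s.used (s.used + K.card) := by
        -- At price zero the computed clicks `B' i / 0` are `0`, and the empty schedule realizes
        -- them.
        rcases eq_or_ne p 0 with hp | hp
        · exact ⟨fun _ => ∅, ⟨by simp, by simp, by simp⟩, by simp [Schedule.clicks, hp], by simp⟩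
        · obtain ⟨σ, h1, _, h3, h4⟩ := exists_block_schedule D s.used K (fun i => B' i / p)
            (fun T hT => hr.sum_div_le (hT.trans hr.block_subset))
            (hr.sum_block_div (pos_iff_ne_zero.2 hp))
          exact ⟨σ, h1, h3, h4⟩
      refine ⟨fun i => if i ∈ K then σ i else ρ i,
        hσ.piecewise hρ (fun i _ a ha => (hσs i a ha).1) fun i a ha => (hρs i a ha).2,
        fun i => ?_, fun i a ha => ?_⟩
      · by_cases hi : i ∈ K
        · have := hσc i hi
          simpa [Schedule.clicks, State.allocate, hi] using this
        · have := hρc i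
          simpa [Schedule.clicks, State.allocate, hi] using this
      · by_cases hi : i ∈ K
        · simp only [hi, if_true] at ha
          have := hσs i a ha
          simp only [State.allocate, hi, if_true]
          exact ⟨this, this.2⟩
        · simp only [hi, if_false] at ha
          have := hρs i a ha
          simp only [State.allocate, hi, if_false]
          exact ⟨this.1, this.2.trans_le (Nat.le_add_right _ _)⟩)).1
  obtain ⟨σ, h1, h2, h3⟩ := key
  exact ⟨σ, h1, h2, fun i a ha => (h3 i a ha).1⟩

end Scheduling

/-! ### Existence, monotonicity and truthfulness of the mechanism -/

section Truthful
variable {ι : Type*} [LinearOrder ι]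

theorem bid_update (r : ι → Declaration) (i : ι) (d : Declaration) :
    (fun j => (Function.update r i d j).bid) =
      Function.update (fun j => (r j).bid) i d.bid := by
  funext j
  exact Function.apply_update (fun _ => Declaration.bid) r i d j

theorem budget_update (r : ι → Declaration) (i : ι) (d : Declaration) :
    (fun j => (Function.update r i d j).budget) =
      Function.update (fun j => (r j).budget) i d.budget := by
  funext j
  exact Function.apply_update (fun _ => Declaration.budget) r i d j

variable [Fintype ι] {m : ℕ} {D : Fin m → ℝ≥0}

theorem exists_isPriceSetting (hD : StrictAnti D) :
    ∃ M : Mechanism ι D, M.IsPriceSetting := by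
  choose σ h1 h2 h3 using fun r : ι → Declaration =>
    exists_schedule_priceSetting hD (fun j => (r j).bid) (fun j => (r j).budget)
  have hc := fun r : ι → Declaration => priceSetting_certificate (pad_antitone hD)
    (fun j => (r j).bid) (fun j => (r j).budget)
  refine ⟨⟨σ, fun r => (priceSetting (fun j => (r j).bid) (fun j => (r j).budget)
    (pad D)).price, h1, fun r => (hc r).1, fun r i => ?_⟩,
    fun r i => ⟨h2 r i, rfl, h3 r i⟩⟩
  rw [h2, ← NNReal.coe_mul, NNReal.coe_le_coe]
  exact (hc r).2.1 i

theorem clicks_le_clicks_of_le (hD : StrictAnti D) {M : Mechanism ι D} (hM : M.IsPriceSetting)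
    (i : ι) (r : ι → Declaration) {d d' : Declaration} (hbid : d.bid ≤ d'.bid)
    (hbudget : d.budget ≤ d'.budget) :
    M.clicks (Function.update r i d) i ≤ M.clicks (Function.update r i d') i := by
  have hA := pad_antitone hD
  rw [(hM _ i).1, (hM _ i).1, NNReal.coe_le_coe, bid_update, budget_update, bid_update,
    budget_update]
  obtain ⟨-, -, τ, h, -⟩ := priceSetting_certificate hA
    (Function.update (fun j => (r j).bid) i d.bid)
    (Function.update (fun j => (r j).budget) i d.budget)
  obtain ⟨-, -, τ', h', -⟩ := priceSetting_certificate hA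
    (Function.update (fun j => (r j).bid) i d'.bid)
    (Function.update (fun j => (r j).budget) i d'.budget)
  refine h.clicks_mono hA h' (fun j hj => ?_) (fun j hj => ?_) ?_ ?_
  · rw [Function.update_of_ne hj, Function.update_of_ne hj]
  · rw [Function.update_of_ne hj, Function.update_of_ne hj]
  · rwa [Function.update_self, Function.update_self]
  · rwa [Function.update_self, Function.update_self]

/-- The outcome of `d` is re-certified for a declaration with budget `x` and bid `y` that nowhere
exceeds `t`. `Certificate.clicks_mono` compares arbitrary certificates, so this one need not arise
from a run. -/
theorem priceSetting_clicks_le_of_affordable {E : ℕ → ℝ≥0} (hE : Antitone E) (b B : ι → ℝ≥0)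
    (i : ι) (t d : Declaration) (hd : d.bid ≤ t.bid ∨ ∀ j, j < i → b j ≠ t.bid)
    (hp : (priceSetting (Function.update b i d.bid) (Function.update B i d.budget) E).price i ≤
      t.bid)
    (hpay : (priceSetting (Function.update b i d.bid) (Function.update B i d.budget) E).clicks i *
      (priceSetting (Function.update b i d.bid) (Function.update B i d.budget) E).price i ≤
        t.budget) :
    (priceSetting (Function.update b i d.bid) (Function.update B i d.budget) E).clicks i ≤
      (priceSetting (Function.update b i t.bid) (Function.update B i t.budget) E).clicks i := by
  obtain ⟨-, -, τ, h, hbid, hprice⟩ := priceSetting_certificate hE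
    (Function.update b i d.bid) (Function.update B i d.budget)
  obtain ⟨-, -, τ', h', -⟩ := priceSetting_certificate hE
    (Function.update b i t.bid) (Function.update B i t.budget)
  set c := (priceSetting (Function.update b i d.bid) (Function.update B i d.budget) E).clicks
  rcases eq_or_ne (c i) 0 with h0 | h0
  · rw [h0]; exact zero_le
  rw [hprice i h0] at hp hpay
  obtain ⟨x, hx, h1⟩ : ∃ x, x ≤ t.budget ∧
      Certificate E (Function.update b i d.bid) (Function.update B i x) c τ := by
    rcases le_total d.budget t.budget with hle | hle
    · exact ⟨_, hle, h⟩
    · have := h.truncate_budget (i := i) (x := t.budget) (by rwa [Function.update_self])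
        (pos_iff_ne_zero.2 h0) hpay
      rw [Function.update_idem] at this
      exact ⟨_, le_rfl, this⟩
  obtain ⟨y, hy, τ₁, h2⟩ : ∃ y, y ≤ t.bid ∧ ∃ τ₁,
      Certificate E (Function.update b i y) (Function.update B i x) c τ₁ := by
    rcases le_or_gt d.bid t.bid with hle | hlt
    · exact ⟨_, hle, τ, h1⟩
    · obtain ⟨τ₁, h2⟩ := h1.lower_bid (i := i) (m := t.bid) (by rwa [Function.update_self])
        (fun l k x hl => hbid l _ k x hl)
        (fun j hj => by
          rw [Function.update_of_ne hj.ne]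
          exact hd.resolve_left hlt.not_ge j hj) hp
      rw [Function.update_idem] at h2
      exact ⟨_, le_rfl, τ₁, h2⟩
  refine h2.clicks_mono hE h' (fun j hj => ?_) (fun j hj => ?_) ?_ ?_
  · rw [Function.update_of_ne hj, Function.update_of_ne hj]
  · rw [Function.update_of_ne hj, Function.update_of_ne hj]
  · rwa [Function.update_self, Function.update_self]
  · rwa [Function.update_self, Function.update_self]

theorem utility_le_utility_truth (hD : StrictAnti D) {M : Mechanism ι D} (hM : M.IsPriceSetting)
    (i : ι) (t : Declaration) (r : ι → Declaration) (d : Declaration)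
    (hd : d.bid ≤ t.bid ∨ ∀ j, j < i → (r j).bid ≠ t.bid) :
    M.utility t i (Function.update r i d) ≤ M.utility t i (Function.update r i t) := by
  -- A truthful bidder is never at `-∞`: her price and her charge respect her declaration.
  have htruth : M.utility t i (Function.update r i t) =
      (M.clicks (Function.update r i t) i : EReal) := by
    have h1 := M.price_le_bid (Function.update r i t) i
    have h2 := M.charge_le_budget (Function.update r i t) i
    rw [Function.update_self] at h1 h2
    rw [Mechanism.utility, clickUtility, if_pos]
    exact ⟨NNReal.coe_le_coe.2 h1, by rwa [mul_comm]⟩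
  rw [htruth, Mechanism.utility, clickUtility]
  split_ifs with h
  · rw [EReal.coe_le_coe_iff]
    rw [(hM _ i).1, (hM _ i).2.1, bid_update, budget_update] at h
    rw [(hM _ i).1, (hM _ i).1, NNReal.coe_le_coe, bid_update, budget_update, bid_update,
      budget_update]
    exact priceSetting_clicks_le_of_affordable (pad_antitone hD) _ _ i t d hd
      (NNReal.coe_le_coe.1 h.1) (by exact_mod_cast h.2)
  · exact bot_le

end Truthful

end AdSlots

end

theorem theorem5 {ι : Type*} [Fintype ι] [LinearOrder ι] {m : ℕ} (D : Fin m → ℝ≥0)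
    (hD : StrictAnti D) :
    (∃ M : AdSlots.Mechanism ι D, M.IsPriceSetting) ∧
    ∀ M : AdSlots.Mechanism ι D, M.IsPriceSetting →
      (∀ (i : ι) (t : AdSlots.Declaration) (r : ι → AdSlots.Declaration)
          (d : AdSlots.Declaration),
        (d.bid ≤ t.bid ∨ ∀ j, j < i → (r j).bid ≠ t.bid) →
        M.utility t i (Function.update r i d) ≤ M.utility t i (Function.update r i t)) ∧
      (∀ (i : ι) (r : ι → AdSlots.Declaration) (d d' : AdSlots.Declaration),
        d.bid ≤ d'.bid → d.budget ≤ d'.budget →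
        M.clicks (Function.update r i d) i ≤ M.clicks (Function.update r i d') i) :=
  ⟨AdSlots.exists_isPriceSetting hD, fun _ hM =>
    ⟨fun i t r d hd => AdSlots.utility_le_utility_truth hD hM i t r d hd,
      fun i r _ _ hb hB => AdSlots.clicks_le_clicks_of_le hD hM i r hb hB⟩⟩
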